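/- Work over $\mathbb{C}$; all modules are finite-dimensional left modules. For a finite-dimensional Hopf algebra $H$ with (two-sided) integral $\Lambda$ normalized by $\varepsilon(\Lambda)=1$, and an $H$-module $V$ with character $\chi$, the $m$-th indicator is $\nu_m(V)=\chi\big(\sum\Lambda_1\Lambda_2\cdots\Lambda_m\big)$, $m\ge 1$; a $G$-module is a module over the group algebra $\mathbb{C}G$. For a finite group $G$, the Drinfel'd double $D(G)=(\mathbb{C}^G)^{cop}\otimes\mathbb{C}G$ has basis $p_g\bowtie h$ ($g,h\in G$), product $(p_g\bowtie x)(p_{g'}\bowtie y)=\delta_{g,\,xg'x^{-1}}\,p_g\bowtie xy$, coproduct $\Delta(p_g\bowtie h)=\sum_{xy=g}(p_y\bowtie h)\otimes(p_x\bowtie h)$, counit $\varepsilon(p_g\bowtie h)=\delta_{g,1}$ and antipode $S(p_g\bowtie h)=p_{h^{-1}g^{-1}h}\bowtie h^{-1}$. For integers $l\ge 3$ and $k\ge 1$ with $4\mid k$, let $$G_{l,k}=\langle a,u,v \mid a^{2^l}=u^k=v^2=1,\ uau^{-1}=a^{2^{l-1}+1},\ vav=a^{2^{l-1}-1},\ vuv=u^{-1}\rangle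 .$$ **Theorem.** For all such $l,k$, the group $G=G_{l,k}$ is finite, it is the semidirect product $\mathbb{Z}_{2^l}\rtimes D_k$ (where $D_k$ is the dihedral group of order $2k$, whose generators $u$ and $v$ act on $\mathbb{Z}_{2^l}$ by multiplication by $2^{l-1}+1$ and $2^{l-1}-1$), and: 1. $G$ is completely real: every element of $G$ is conjugate to its inverse. 2. $G$ is generated by involutions (elements of order $2$). 3. For every $g\in G$ the centralizer $C_G(g)$ is an $M$-group, i.e. each of its irreducible complex characters is induced from a linear character of a subgroup. In particular $G$ is an $M$-group. 4. $G$ is totally orthogonal: every irreducible $G$-module $V$ carries a nondegenerate symmetric $G$-invariant bilinear form and has $\nu_2(V)=1$. 5. $\nu_m(V)$ is a nonnegative real number for every $G$-module $V$ and every $m\ge 1$. 6. Every $D(G)$-module $V$ (in particular every irreducible one) is self-dual, i.e. $V\cong V^*$ as $D(G)$-modules, where $h$ acts on $V^*$ by $(hf)(w)=f(S(h)w)$. 7. There is an irreducible $D(G)$-module $W$ with $\nu_2(W)=-1$. Moreover, there are infinitely many pairwise non-isomorphic groups among the $G_{l,k}$. In particular, infinitely many finite groups have properties 1-7. -/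

import Mathlib

noncomputable section

open scoped TensorProduct

/-! ### Integrals and higher indicators for Hopf algebras -/

section Indicators

variable (H : Type*) [Ring H] [HopfAlgebra ℂ H]

/-- `Λ` is a (two-sided) integral of `H`, normalized by `ε(Λ) = 1`. -/
structure IsNormalizedIntegral (Λ : H) : Prop where
  mul_left : ∀ h : H, h * Λ = Coalgebra.counit (R := ℂ) h • Λ
  mul_right : ∀ h : H, Λ * h = Coalgebra.counit (R := ℂ) h • Λ
  counit_eq_one : Coalgebra.counit (R := ℂ) Λ = 1

variable {H} in
/-- A normalized integral is unique. -/
theorem IsNormalizedIntegral.unique {Λ Λ' : H} (h : IsNormalizedIntegral H Λ)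
    (h' : IsNormalizedIntegral H Λ') : Λ = Λ' := by
  have h1 := h.mul_left Λ'
  have h2 := h'.mul_right Λ
  rw [h'.counit_eq_one, one_smul] at h1
  rw [h.counit_eq_one, one_smul] at h2
  exact h1.symm.trans h2

/-- The normalized integral of `H`. It is only meaningful if one exists, which is shown below for
group algebras and for Drinfel'd doubles of finite groups. -/
def normalizedIntegral : H := Classical.epsilon (IsNormalizedIntegral H)

variable {H} in
theorem IsNormalizedIntegral.normalizedIntegral_eq {Λ : H} (h : IsNormalizedIntegral H Λ) :
    normalizedIntegral H = Λ :=
  IsNormalizedIntegral.unique (Classical.epsilon_spec ⟨Λ, h⟩) h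

/-- The `m`-th Sweedler power `x ↦ ∑ x₁ x₂ ⋯ xₘ`, that is, the `m`-th power of the identity
for the convolution product of `Hom(H, H)`. -/
def sweedlerPower (m : ℕ) : H →ₗ[ℂ] H :=
  (WithConv.toConv (LinearMap.id : H →ₗ[ℂ] H) ^ m).ofConv

variable (V : Type*) [AddCommGroup V] [Module ℂ V] [Module H V] [IsScalarTower ℂ H V]

/-- The character of an `H`-module: `h` is sent to the trace of `v ↦ h • v`. -/
def moduleCharacter : H →ₗ[ℂ] ℂ :=
  LinearMap.trace ℂ V ∘ₗ (Algebra.lsmul ℂ ℂ V : H →ₐ[ℂ] Module.End ℂ V).toLinearMap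

/-- The `m`-th indicator `ν_m(V) = χ_V(Λ^[m])` of an `H`-module. -/
def indicator (m : ℕ) : ℂ :=
  moduleCharacter H V (sweedlerPower H m (normalizedIntegral H))

/-- `V` is isomorphic as an `H`-module to its linear dual, on which `h` acts by
`(h • f)(w) = f (S(h) • w)`, with `S` the antipode. -/
def IsSelfDualModule : Prop :=
  ∃ e : V ≃ₗ[ℂ] Module.Dual ℂ V,
    ∀ (h : H) (v w : V), e (h • v) w = e v (HopfAlgebra.antipode ℂ h • w)

end Indicators

/-! ### Properties of finite groups -/

section Groups

variable (G : Type) [Group G]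

/-- Every element is conjugate to its inverse. -/
def IsCompletelyReal : Prop := ∀ g : G, IsConj g g⁻¹

/-- `G` is generated by its elements of order two. -/
def IsGeneratedByInvolutions : Prop := Subgroup.closure {g : G | orderOf g = 2} = ⊤

/-- Every irreducible complex `G`-module carries a nondegenerate symmetric `G`-invariant
bilinear form. -/
def IsTotallyOrthogonal : Prop :=
  ∀ (V : Type) [AddCommGroup V] [Module ℂ V] [FiniteDimensional ℂ V]
    [Module (MonoidAlgebra ℂ G) V] [IsScalarTower ℂ (MonoidAlgebra ℂ G) V],
    IsSimpleModule (MonoidAlgebra ℂ G) V →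
      ∃ B : LinearMap.BilinForm ℂ V, B.Nondegenerate ∧ B.IsSymm ∧
        ∀ (g : G) (v w : V),
          B (MonoidAlgebra.of ℂ G g • v) (MonoidAlgebra.of ℂ G g • w) = B v w

open scoped Classical in
/-- The character of the finite group `G` induced from the linear character `φ` of `K`:
`φ^G(g) = (1 / |K|) ∑ φ(x⁻¹ g x)`, over the `x` in `G` with `x⁻¹ g x ∈ K`. -/
def inducedCharacter {G : Type} [Group G] (K : Subgroup G) (φ : K →* ℂˣ) (g : G) : ℂ :=
  (Nat.card K : ℂ)⁻¹ *
    ∑ᶠ x : G, if hx : x⁻¹ * g * x ∈ K then ((φ ⟨x⁻¹ * g * x, hx⟩ : ℂˣ) : ℂ) else 0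

/-- Every irreducible complex character of `G` is induced from a linear character of
a subgroup. -/
def IsMGroup : Prop :=
  ∀ (V : Type) [AddCommGroup V] [Module ℂ V] [FiniteDimensional ℂ V]
    [Module (MonoidAlgebra ℂ G) V] [IsScalarTower ℂ (MonoidAlgebra ℂ G) V],
    IsSimpleModule (MonoidAlgebra ℂ G) V →
      ∃ (K : Subgroup G) (φ : K →* ℂˣ), ∀ g : G,
        moduleCharacter (MonoidAlgebra ℂ G) V (MonoidAlgebra.of ℂ G g) = inducedCharacter K φ g

end Groups

/-! ### The Drinfel'd double of a finite group -/

/-- The underlying space of the Drinfel'd double `D(G)` over `ℂ`: an element is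
`∑ f (g, h) p_g ⋈ h`, where `p_g` is the dual basis of the functions on `G`. -/
def DrinfeldDouble (G : Type*) : Type _ := G × G → ℂ

namespace DrinfeldDouble

variable {G : Type*}

instance : AddCommGroup (DrinfeldDouble G) := inferInstanceAs (AddCommGroup (G × G → ℂ))

instance : Module ℂ (DrinfeldDouble G) := inferInstanceAs (Module ℂ (G × G → ℂ))

/-- The coefficient of `p_g ⋈ h`. -/
def coeff (g h : G) : DrinfeldDouble G →ₗ[ℂ] ℂ := LinearMap.proj (φ := fun _ : G × G => ℂ) (g, h)

@[ext]
theorem ext {a b : DrinfeldDouble G} (hab : ∀ g h, coeff g h a = coeff g h b) : a = b :=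
  funext fun x => hab x.1 x.2

section Basis

variable [DecidableEq G]

/-- The basis element `p_g ⋈ h`. -/
def p (g h : G) : DrinfeldDouble G := (Pi.single (g, h) 1 : G × G → ℂ)

theorem coeff_p (g h g' h' : G) : coeff g h (p g' h') = if g = g' ∧ h = h' then 1 else 0 := by
  show (Pi.single (g', h') 1 : G × G → ℂ) (g, h) = _
  simp [Pi.single_apply]

variable [Fintype G]

theorem eq_sum (a : DrinfeldDouble G) : a = ∑ g, ∑ h, coeff g h a • p g h := by
  ext g h
  simp only [map_sum, map_smul, coeff_p, smul_eq_mul, mul_ite, mul_one, mul_zero]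
  rw [Finset.sum_eq_single g, Finset.sum_eq_single h] <;> simp +contextual [eq_comm]

theorem hom_ext {M : Type*} [AddCommMonoid M] [Module ℂ M] {f f' : DrinfeldDouble G →ₗ[ℂ] M}
    (hf : ∀ g h, f (p g h) = f' (p g h)) : f = f' := by
  refine LinearMap.ext fun a => ?_
  rw [eq_sum a]
  simp [map_sum, hf]

end Basis

variable [Group G]

section Algebra

set_option linter.unusedSectionVars false

variable [DecidableEq G] [Fintype G]

/-- The unit is `∑ p_g ⋈ 1`, the sum being over all `g`. -/
instance : One (DrinfeldDouble G) := ⟨(fun x => if x.2 = 1 then 1 else 0 : G × G → ℂ)⟩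

/-- The product, with `(p_g ⋈ x) (p_g' ⋈ y) = p_g (x · p_g') ⋈ x y`, where `x · p_g'` is
`p_(x g' x⁻¹)`. -/
instance : Mul (DrinfeldDouble G) :=
  ⟨fun a b => (fun z => ∑ x, coeff z.1 x a * coeff (x⁻¹ * z.1 * x) (x⁻¹ * z.2) b : G × G → ℂ)⟩

theorem coeff_one (g h : G) : coeff g h (1 : DrinfeldDouble G) = if h = 1 then 1 else 0 := rfl

theorem coeff_mul (g h : G) (a b : DrinfeldDouble G) :
    coeff g h (a * b) = ∑ x, coeff g x a * coeff (x⁻¹ * g * x) (x⁻¹ * h) b := rfl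

instance : Ring (DrinfeldDouble G) where
  __ := (inferInstance : AddCommGroup (DrinfeldDouble G))
  left_distrib a b c := by ext; simp [coeff_mul, mul_add, Finset.sum_add_distrib]
  right_distrib a b c := by ext; simp [coeff_mul, add_mul, Finset.sum_add_distrib]
  zero_mul a := by ext; simp [coeff_mul]
  mul_zero a := by ext; simp [coeff_mul]
  one_mul a := by ext; simp [coeff_mul, coeff_one]
  mul_one a := by ext; simp [coeff_mul, coeff_one, inv_mul_eq_one]
  mul_assoc a b c := by
    ext g h
    simp only [coeff_mul, Finset.sum_mul, Finset.mul_sum]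
    rw [Finset.sum_comm]
    refine Finset.sum_congr rfl fun y _ => ?_
    refine Fintype.sum_equiv (Equiv.mulLeft y⁻¹) _ _ fun x => ?_
    simp [mul_assoc]

instance : Algebra ℂ (DrinfeldDouble G) :=
  Algebra.ofModule
    (fun r a b => by ext; simp [coeff_mul, Finset.mul_sum, mul_assoc])
    (fun r a b => by ext; simp [coeff_mul, Finset.mul_sum, mul_left_comm])

theorem p_mul_p (g x g' y : G) :
    p g x * p g' y = if g = x * g' * x⁻¹ then p g (x * y) else 0 := by
  ext a b
  rw [coeff_mul, Finset.sum_eq_single x]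
  · by_cases hg : g = x * g' * x⁻¹
    · subst hg
      by_cases ha : a = x * g' * x⁻¹
      · subst ha
        simp [coeff_p, mul_assoc, inv_mul_eq_iff_eq_mul]
      · simp [coeff_p, ha]
    · rw [if_neg hg]
      by_cases ha : a = g
      · subst ha
        have : ¬ (x⁻¹ * a * x = g') := fun h => hg (by rw [← h]; group)
        simp [coeff_p, this]
      · simp [coeff_p, ha]
  · intro z _ hz
    simp [coeff_p, hz]
  · simp

theorem one_eq : (1 : DrinfeldDouble G) = ∑ g, p g 1 := by
  ext a b
  simp [coeff_one, coeff_p, ite_and]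

end Algebra

section Coalgebra

variable [DecidableEq G] [Fintype G]

/-- `ε (p_g ⋈ h) = δ_(g, 1)`, and `Δ (p_g ⋈ h) = ∑ (p_y ⋈ h) ⊗ (p_x ⋈ h)` over the `x`, `y`
with `x y = g`: the tensor product of the coalgebra `(ℂ^G)^cop` with the group coalgebra. -/
instance : CoalgebraStruct ℂ (DrinfeldDouble G) where
  comul := ∑ x, ∑ y, ∑ h, (coeff (x * y) h).smulRight (p y h ⊗ₜ[ℂ] p x h)
  counit := ∑ h, coeff 1 h

theorem counit_p (g h : G) :
    Coalgebra.counit (R := ℂ) (p g h : DrinfeldDouble G) = if g = 1 then 1 else 0 := by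
  show (∑ h', coeff 1 h' : DrinfeldDouble G →ₗ[ℂ] ℂ) (p g h) = _
  simp [LinearMap.sum_apply, coeff_p, ite_and, eq_comm]

theorem comul_p (g h : G) :
    Coalgebra.comul (R := ℂ) (p g h : DrinfeldDouble G) =
      ∑ x, p (x⁻¹ * g) h ⊗ₜ[ℂ] p x h := by
  show (∑ x, ∑ y, ∑ h', (coeff (x * y) h').smulRight (p y h' ⊗ₜ[ℂ] p x h') :
    DrinfeldDouble G →ₗ[ℂ] _) (p g h) = _
  simp only [LinearMap.sum_apply, LinearMap.smulRight_apply, coeff_p]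
  refine Finset.sum_congr rfl fun x _ => ?_
  rw [Finset.sum_eq_single (x⁻¹ * g), Finset.sum_eq_single h]
  · simp
  · intro b _ hb
    simp [hb]
  · simp
  · intro b _ hb
    refine Finset.sum_eq_zero fun c _ => ?_
    rw [if_neg, zero_smul]
    rintro ⟨h1, -⟩
    exact hb (by rw [← h1]; group)
  · simp

instance : Coalgebra ℂ (DrinfeldDouble G) where
  coassoc := by
    refine hom_ext fun g h => ?_
    simp only [LinearMap.comp_apply, comul_p, map_sum, LinearMap.rTensor_tmul,
      LinearMap.lTensor_tmul, LinearEquiv.coe_coe, TensorProduct.sum_tmul, TensorProduct.tmul_sum,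
      TensorProduct.assoc_tmul]
    rw [Finset.sum_comm' (t' := Finset.univ) (s' := fun _ => Finset.univ) (by simp)]
    conv_rhs => rw [Finset.sum_comm' (t' := Finset.univ) (s' := fun _ => Finset.univ) (by simp)]
    rw [Finset.sum_comm]
    refine Finset.sum_congr rfl fun x _ => ?_
    refine Fintype.sum_equiv (Equiv.mulLeft x) _ _ fun z => ?_
    simp [mul_assoc]
  rTensor_counit_comp_comul := by
    refine hom_ext fun g h => ?_
    simp only [LinearMap.comp_apply, comul_p, map_sum, LinearMap.rTensor_tmul, counit_p]
    rw [Finset.sum_eq_single g]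
    · simp
    · intro b _ hb
      rw [if_neg (by rwa [inv_mul_eq_one]), TensorProduct.zero_tmul]
    · simp
  lTensor_counit_comp_comul := by
    refine hom_ext fun g h => ?_
    simp only [LinearMap.comp_apply, comul_p, map_sum, LinearMap.lTensor_tmul, counit_p]
    rw [Finset.sum_eq_single 1]
    · simp
    · intro b _ hb
      rw [if_neg hb, TensorProduct.tmul_zero]
    · simp

theorem counit_mul_p (g x g' y : G) :
    Coalgebra.counit (R := ℂ) (p g x * p g' y) =
      Coalgebra.counit (R := ℂ) (p g x) * Coalgebra.counit (R := ℂ) (p g' y) := by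
  rw [p_mul_p, counit_p, counit_p]
  by_cases hg : g = 1
  · subst hg
    by_cases hg' : g' = 1
    · subst hg'
      simp [counit_p]
    · have : ¬ (1 = x * g' * x⁻¹) := fun h => hg' (by
        rw [eq_comm, mul_inv_eq_one] at h
        simpa using h)
      simp [hg', this]
  · split_ifs <;> simp [counit_p, hg]

theorem comul_mul_p (g x g' y : G) :
    Coalgebra.comul (R := ℂ) (p g x * p g' y) =
      Coalgebra.comul (R := ℂ) (p g x) * Coalgebra.comul (R := ℂ) (p g' y) := by
  rw [comul_p, comul_p, Finset.sum_mul_sum]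
  simp only [Algebra.TensorProduct.tmul_mul_tmul, p_mul_p]
  have key : ∀ s : G, (∑ t, ((if s⁻¹ * g = x * (t⁻¹ * g') * x⁻¹ then p (s⁻¹ * g) (x * y) else 0) ⊗ₜ[ℂ]
      (if s = x * t * x⁻¹ then p s (x * y) else 0) : DrinfeldDouble G ⊗[ℂ] DrinfeldDouble G)) =
      if g = x * g' * x⁻¹ then p (s⁻¹ * g) (x * y) ⊗ₜ[ℂ] p s (x * y) else 0 := by
    intro s
    rw [Finset.sum_eq_single (x⁻¹ * s * x)]
    · have e1 : s = x * (x⁻¹ * s * x) * x⁻¹ := by group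
      have e2 : (s⁻¹ * g = x * ((x⁻¹ * s * x)⁻¹ * g') * x⁻¹) ↔ g = x * g' * x⁻¹ := by
        have : x * ((x⁻¹ * s * x)⁻¹ * g') * x⁻¹ = s⁻¹ * (x * g' * x⁻¹) := by group
        rw [this, mul_right_inj]
      rw [if_pos e1]
      simp only [e2]
      split_ifs <;> simp
    · intro t _ ht
      rw [if_neg (c := s = x * t * x⁻¹), TensorProduct.tmul_zero]
      intro h
      exact ht (by rw [h]; group)
    · simp
  simp only [key]
  split_ifs
  · rw [comul_p]
  · simp

instance : Bialgebra ℂ (DrinfeldDouble G) where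
  counit_one := by
    rw [one_eq, map_sum]
    simp [counit_p]
  mul_compr₂_counit := by
    refine hom_ext fun g x => hom_ext fun g' y => ?_
    exact counit_mul_p g x g' y
  comul_one := by
    rw [one_eq, map_sum, Algebra.TensorProduct.one_def, one_eq]
    simp only [comul_p, TensorProduct.sum_tmul, TensorProduct.tmul_sum]
    rw [Finset.sum_comm]
    refine Finset.sum_congr rfl fun x _ => ?_
    exact Fintype.sum_equiv (Equiv.mulLeft x⁻¹) _ _ fun z => rfl
  mul_compr₂_comul := by
    refine hom_ext fun g x => hom_ext fun g' y => ?_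
    exact comul_mul_p g x g' y

/-- The antipode as a linear map: `S (p_g ⋈ h) = p_(h⁻¹ g⁻¹ h) ⋈ h⁻¹`. -/
def antipodeMap : DrinfeldDouble G →ₗ[ℂ] DrinfeldDouble G :=
  ∑ g, ∑ h, (coeff g h).smulRight (p (h⁻¹ * g⁻¹ * h) h⁻¹)

theorem antipodeMap_p (g h : G) :
    antipodeMap (p g h : DrinfeldDouble G) = p (h⁻¹ * g⁻¹ * h) h⁻¹ := by
  simp only [antipodeMap, LinearMap.sum_apply, LinearMap.smulRight_apply, coeff_p]
  rw [Finset.sum_eq_single g, Finset.sum_eq_single h]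
  · simp
  · intro b _ hb
    simp [hb]
  · simp
  · intro b _ hb
    simp [hb]
  · simp

instance : HopfAlgebra ℂ (DrinfeldDouble G) where
  antipode := antipodeMap
  mul_antipode_rTensor_comul := by
    refine hom_ext fun g h => ?_
    simp only [LinearMap.comp_apply, comul_p, map_sum, LinearMap.rTensor_tmul, antipodeMap_p,
      LinearMap.mul'_apply, p_mul_p, counit_p, Algebra.linearMap_apply]
    by_cases hg : g = 1
    · subst hg
      rw [if_pos rfl, map_one, one_eq]
      refine Fintype.sum_equiv ((Equiv.mulLeft h⁻¹).trans (Equiv.mulRight h)) _ _ fun x => ?_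
      simp
    · rw [if_neg hg, map_zero]
      refine Finset.sum_eq_zero fun x _ => ?_
      rw [if_neg]
      intro h1
      apply hg
      have h2 : g⁻¹ * x = x := by
        have := congrArg (fun z => h * z * h⁻¹) h1
        simpa [mul_assoc] using this
      simpa using h2
  mul_antipode_lTensor_comul := by
    refine hom_ext fun g h => ?_
    simp only [LinearMap.comp_apply, comul_p, map_sum, LinearMap.lTensor_tmul, antipodeMap_p,
      LinearMap.mul'_apply, p_mul_p, counit_p, Algebra.linearMap_apply]
    by_cases hg : g = 1
    · subst hg
      rw [if_pos rfl, map_one, one_eq]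
      refine Fintype.sum_equiv (Equiv.inv G) _ _ fun x => ?_
      simp [mul_assoc]
    · rw [if_neg hg, map_zero]
      refine Finset.sum_eq_zero fun x _ => ?_
      rw [if_neg]
      intro h1
      apply hg
      simpa [mul_assoc] using h1

theorem antipode_p (g h : G) :
    HopfAlgebra.antipode ℂ (p g h : DrinfeldDouble G) = p (h⁻¹ * g⁻¹ * h) h⁻¹ :=
  antipodeMap_p g h

/-- The normalized integral of `D(G)` is `|G|⁻¹ ∑ p_1 ⋈ h`, the sum being over all `h`. -/
theorem isNormalizedIntegral :
    IsNormalizedIntegral (DrinfeldDouble G) ((Fintype.card G : ℂ)⁻¹ • ∑ h, p 1 h) where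
  mul_left a := by
    rw [eq_sum a]
    simp only [Finset.sum_mul, map_sum, Finset.sum_smul, map_smul, counit_p]
    refine Finset.sum_congr rfl fun g _ => Finset.sum_congr rfl fun x _ => ?_
    rw [smul_mul_assoc, mul_smul_comm, Finset.mul_sum, smul_assoc]
    congr 1
    by_cases hg : g = 1
    · subst hg
      simp only [p_mul_p, if_true, one_smul]
      congr 1
      refine Fintype.sum_equiv (Equiv.mulLeft x) _ _ fun y => ?_
      simp
    · simp [p_mul_p, hg]
  mul_right a := by
    rw [eq_sum a]
    simp only [Finset.mul_sum, map_sum, Finset.sum_smul, map_smul, counit_p]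
    refine Finset.sum_congr rfl fun g _ => Finset.sum_congr rfl fun x _ => ?_
    rw [smul_mul_assoc, mul_smul_comm, Finset.sum_mul, smul_comm, smul_assoc]
    congr 1
    by_cases hg : g = 1
    · subst hg
      simp only [p_mul_p, if_true, one_smul]
      congr 1
      refine Fintype.sum_equiv (Equiv.mulRight x) _ _ fun y => ?_
      simp
    · have : ∀ y : G, ¬ (1 = y * g * y⁻¹) := fun y h => hg (by
        rw [eq_comm, mul_inv_eq_one] at h
        simpa using h)
      simp [p_mul_p, hg, this]
  counit_eq_one := by
    simp [map_sum, counit_p]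

end Coalgebra

end DrinfeldDouble

/-- The normalized integral of the group algebra is `|G|⁻¹ ∑ g`. -/
theorem MonoidAlgebra.isNormalizedIntegral {G : Type*} [Group G] [Fintype G] :
    IsNormalizedIntegral (MonoidAlgebra ℂ G)
      ((Fintype.card G : ℂ)⁻¹ • ∑ g : G, MonoidAlgebra.of ℂ G g) where
  mul_left a := by
    induction a using MonoidAlgebra.induction_on with
    | of g =>
      rw [mul_smul_comm, Finset.mul_sum, smul_comm]
      congr 1
      rw [MonoidAlgebra.of_apply, MonoidAlgebra.counit_single, CommSemiring.counit_apply, one_smul]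
      refine Fintype.sum_equiv (Equiv.mulLeft g) _ _ fun x => ?_
      simp
    | add a b ha hb => rw [add_mul, ha, hb, map_add, add_smul]
    | smul r a ha => rw [smul_mul_assoc, ha, map_smul, smul_assoc]
  mul_right a := by
    induction a using MonoidAlgebra.induction_on with
    | of g =>
      rw [smul_mul_assoc, Finset.sum_mul, smul_comm]
      congr 1
      rw [MonoidAlgebra.of_apply, MonoidAlgebra.counit_single, CommSemiring.counit_apply, one_smul]
      refine Fintype.sum_equiv (Equiv.mulRight g) _ _ fun x => ?_
      simp
    | add a b ha hb => rw [mul_add, ha, hb, map_add, add_smul]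
    | smul r a ha => rw [mul_smul_comm, ha, map_smul, smul_assoc]
  counit_eq_one := by
    simp [map_sum]

/-! ### The groups -/

/-- Names for the three generators. -/
inductive DihedralExtGen
  | a
  | u
  | v

open DihedralExtGen in
/-- The relators of the presentation
`a^(2^l) = u^k = v^2 = 1`, `u a u⁻¹ = a^(2^(l-1)+1)`, `v a v = a^(2^(l-1)-1)`, `v u v = u⁻¹`. -/
def dihedralExtRels (l k : ℕ) : Set (FreeGroup DihedralExtGen) :=
  let a := FreeGroup.of a
  let u := FreeGroup.of u
  let v := FreeGroup.of v
  {a ^ 2 ^ l, u ^ k, v ^ 2, u * a * u⁻¹ * (a ^ (2 ^ (l - 1) + 1))⁻¹,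
    v * a * v * (a ^ (2 ^ (l - 1) - 1))⁻¹, v * u * v * (u⁻¹)⁻¹}

/-- The group `ℤ_(2^l) ⋊ D_k`, with `D_k` the dihedral group of order `2 k`, given by its
presentation. -/
abbrev DihedralExt (l k : ℕ) : Type := PresentedGroup (dihedralExtRels l k)

end

/-! The presented group is identified with an explicit semidirect product whose elements are the
rotations `R i j` $= a^iu^j$ and the reflections `S i j` $= a^ivu^j$. With $h = 2^{l-1}$, the
relations $2h = h^2 = 0$ make most conjugation questions depend only on the parities of $i$ and $j$.

Two commuting elements are always inverted by a common $t$ (`DihedralModel.exists_inverting`). One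
element alone gives complete reality. For pairs, the group-like element $t$ of $D(G)$ conjugates
$p_g\bowtie h$ to its antipode, while characters vanish on $p_g\bowtie h$ when $g$ and $h$ do not
commute. So the antipode preserves all characters, and averaging with a symmetric separability
element turns this into isomorphisms $V\cong V^*$.

The subgroup $N=\langle a,u^2\rangle$ is abelian and normal with abelian quotient. An irreducible
representation therefore has a weight vector for some normal $K\supseteq N$ whose weight is
stabilized only by $K$ (`exists_isMonomialVector`), and its character is induced from that weight.
This hypothesis passes to subgroups, hence to centralizers. For orthogonality, every $K\supseteq N$
admits $t$ with $t^2=1$ that inverts $K$ modulo $[K,K]$ (`exists_inverting_mod_commutator`). Thus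
$t$ inverts the weight, which produces an explicit symmetric invariant form and $\nu_2=1$.

For higher indicators, $\sum_x\chi(x^m)$ is rewritten, by reindexing exponents through units and by
conjugation, as a sum of traces of representations pulled back along group homomorphisms. Each such
sum is a group order times the dimension of a space of invariants.

For the indicator $-1$, take $g=av$. Its centralizer is abelian, and every element inverting $g$ has
the same square $z=g^2=a^h\ne1$. A linear character $r$ of $C_G(g)$ with $r(z)=-1$ induces an
irreducible $D(G)$-module with $\nu_2=|C_G(g)|^{-1}\sum_{gxg=x}r(x^2)=-1$. -/

noncomputable section

open scoped TensorProduct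

/-! ### A model of the groups -/

namespace DihedralModel

section Coefficients

variable (l : ℕ)

/-- The residue `2 ^ (l - 1)`. -/
def half : ZMod (2 ^ l) := 2 ^ (l - 1)

/-- The residue `2 ^ (l - 2)`. -/
def quarter : ZMod (2 ^ l) := 2 ^ (l - 2)

theorem two_pow_eq_zero {l m : ℕ} (h : l ≤ m) : (2 : ZMod (2 ^ l)) ^ m = 0 := by
  have h1 : (2 : ZMod (2 ^ l)) ^ l = 0 := by exact_mod_cast ZMod.natCast_self (2 ^ l)
  rw [← Nat.add_sub_cancel' h, pow_add, h1, zero_mul]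

theorem exists_eq_two_mul_or {l : ℕ} (i : ZMod (2 ^ l)) : ∃ j, i = 2 * j ∨ i = 2 * j + 1 := by
  obtain ⟨m, rfl⟩ := ZMod.natCast_zmod_surjective i
  obtain ⟨c, hc⟩ := Nat.even_or_odd' m
  refine ⟨c, hc.imp (fun h => ?_) (fun h => ?_)⟩ <;> rw [h] <;> push_cast <;> rfl

variable {l} [hl : Fact (3 ≤ l)]

theorem half_eq : half l = 2 * quarter l := by
  have := hl.out
  rw [half, quarter, ← pow_succ']
  congr 1
  omega

theorem two_mul_half : 2 * half l = 0 := by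
  have := hl.out
  rw [half, ← pow_succ']
  exact two_pow_eq_zero (by omega)

/-- The exponent $(l-1)+(l-2)$ reaches $l$ because $l\ge3$. Together with `half_eq` this gives
$(h-2)(1+q)=-2$ for $q$ = `quarter l`, used repeatedly to solve linear equations with coefficient
$h-2$. -/
theorem half_mul_quarter : half l * quarter l = 0 := by
  have := hl.out
  rw [half, quarter, ← pow_add]
  exact two_pow_eq_zero (by omega)

theorem half_mul_half : half l * half l = 0 := by
  rw [half_eq, mul_mul_mul_comm, mul_comm 2 2, mul_assoc, ← mul_assoc 2 (quarter l), ← half_eq,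
    half_mul_quarter, mul_zero]

theorem half_ne_zero : half l ≠ 0 := by
  have := hl.out
  intro h
  have h1 : ((2 ^ (l - 1) : ℕ) : ZMod (2 ^ l)) = 0 := by
    rw [half] at h
    exact_mod_cast h
  rw [ZMod.natCast_eq_zero_iff] at h1
  have := (Nat.pow_dvd_pow_iff_le_right (by norm_num : 1 < 2)).1 h1
  omega

theorem half_mul_cases (i : ZMod (2 ^ l)) : half l * i = 0 ∨ half l * i = half l := by
  obtain ⟨j, rfl | rfl⟩ := exists_eq_two_mul_or i
  · left; linear_combination j * two_mul_half (l := l)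
  · right; linear_combination j * two_mul_half (l := l)

theorem exists_eq_two_mul_of_half_mul {i : ZMod (2 ^ l)} (h : half l * i = 0) :
    ∃ j, i = 2 * j := by
  obtain ⟨j, rfl | rfl⟩ := exists_eq_two_mul_or i
  · exact ⟨j, rfl⟩
  · exact absurd (by linear_combination h - j * two_mul_half (l := l)) (half_ne_zero (l := l))

variable {k : ℕ} [hk : Fact (4 ∣ k)]

/-- The additive map sending odd residues to `2 ^ (l - 1)` and even ones to `0`. -/
def twist : ZMod k →+ ZMod (2 ^ l) :=
  ZMod.lift k ⟨(AddMonoidHom.mulLeft (half l)).comp (Int.castAddHom _), by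
    obtain ⟨c, hc⟩ := hk.out
    simp only [AddMonoidHom.comp_apply, AddMonoidHom.coe_mulLeft, Int.coe_castAddHom, hc]
    push_cast
    linear_combination (2 * c) * two_mul_half (l := l)⟩

theorem twist_intCast (m : ℤ) : twist (m : ZMod k) = half l * (m : ZMod (2 ^ l)) := by
  rw [twist, ZMod.lift_coe]
  rfl

theorem twist_natCast (m : ℕ) : twist (m : ZMod k) = half l * (m : ZMod (2 ^ l)) := by
  simpa using twist_intCast (l := l) (k := k) m

theorem twist_one : twist (1 : ZMod k) = half l := by
  simpa using twist_natCast (l := l) (k := k) 1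

theorem twist_cases (j : ZMod k) : twist (l := l) j = 0 ∨ twist (l := l) j = half l := by
  obtain ⟨m, rfl⟩ := ZMod.intCast_surjective j
  rw [twist_intCast]
  exact half_mul_cases _

theorem two_mul_twist (j : ZMod k) : 2 * twist (l := l) j = 0 := by
  rcases twist_cases (l := l) j with h | h <;> simp [h, two_mul_half]

theorem half_mul_twist (j : ZMod k) : half l * twist (l := l) j = 0 := by
  rcases twist_cases (l := l) j with h | h <;> simp [h, half_mul_half]

theorem twist_mul_twist (i j : ZMod k) : twist (l := l) i * twist (l := l) j = 0 := by
  rcases twist_cases (l := l) i with h | h <;> simp [h, half_mul_twist]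

theorem neg_twist (j : ZMod k) : -twist (l := l) j = twist j := by
  linear_combination -two_mul_twist (l := l) j

theorem twist_neg (j : ZMod k) : twist (l := l) (-j) = twist j := by
  rw [map_neg, neg_twist]

theorem twist_sub (i j : ZMod k) : twist (l := l) (i - j) = twist i + twist j := by
  rw [sub_eq_add_neg, map_add, twist_neg]

theorem twist_natCast_mul (m : ℕ) (j : ZMod k) :
    twist (l := l) ((m : ZMod k) * j) = (m : ZMod (2 ^ l)) * twist j := by
  rw [← nsmul_eq_mul, map_nsmul, nsmul_eq_mul]

/-- A solution of $2j=0$ is a multiple of $k/2$, which is even since $4\mid k$. Defining `twist`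
only needs $k$ even; here divisibility by 4 is essential. -/
theorem twist_eq_zero_of_two_mul [NeZero k] {j : ZMod k} (h : 2 * j = 0) :
    twist (l := l) j = 0 := by
  obtain ⟨m, rfl⟩ := ZMod.natCast_zmod_surjective j
  obtain ⟨c, hc⟩ := hk.out
  have h1 : ((2 * m : ℕ) : ZMod k) = 0 := by push_cast; exact h
  rw [ZMod.natCast_eq_zero_iff, hc] at h1
  obtain ⟨d, hd⟩ := h1
  have : m = 2 * (c * d) := by
    have : 2 * m = 2 * (2 * (c * d)) := by rw [hd]; ring
    omega
  rw [twist_natCast, this]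
  push_cast
  linear_combination (c * d) * two_mul_half (l := l)

variable (l k) in
/-- The scalars by which the dihedral group acts on the cyclic group. -/
def scalar : DihedralGroup k →* ZMod (2 ^ l) where
  toFun
    | .r j => 1 + twist j
    | .sr j => half l - 1 + twist j
  map_one' := by
    show 1 + twist 0 = (1 : ZMod (2 ^ l))
    simp
  map_mul' := by
    rintro (i | i) (j | j) <;>
      simp only [DihedralGroup.r_mul_r, DihedralGroup.r_mul_sr, DihedralGroup.sr_mul_r,
        DihedralGroup.sr_mul_sr, map_add, twist_sub]
    · linear_combination -twist_mul_twist (l := l) i j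
    · linear_combination -twist_mul_twist (l := l) i j + two_mul_twist (l := l) i -
        half_mul_twist (l := l) i
    · linear_combination -twist_mul_twist (l := l) i j + two_mul_twist (l := l) j -
        half_mul_twist (l := l) j
    · linear_combination -twist_mul_twist (l := l) i j + two_mul_twist (l := l) j -
        half_mul_twist (l := l) j + two_mul_twist (l := l) i -
        half_mul_twist (l := l) i - half_mul_half (l := l) + two_mul_half (l := l)

variable (l k) in
/-- The action of the dihedral group on the cyclic group. -/
def action : DihedralGroup k →* MulAut (Multiplicative (ZMod (2 ^ l))) where
  toFun x :=
    { toFun y := .ofAdd (scalar l k x * y.toAdd)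
      invFun y := .ofAdd (scalar l k x⁻¹ * y.toAdd)
      left_inv y := by simp [← mul_assoc, ← map_mul]
      right_inv y := by simp [← mul_assoc, ← map_mul]
      map_mul' y z := by simp [mul_add] }
  map_one' := by ext; simp
  map_mul' x y := by ext; simp [mul_assoc]

theorem action_apply (x : DihedralGroup k) (y : Multiplicative (ZMod (2 ^ l))) :
    action l k x y = Multiplicative.ofAdd (scalar l k x * y.toAdd) := rfl

end Coefficients

end DihedralModel

/-- The semidirect product of the cyclic group of order `2 ^ l` with the dihedral group. -/
abbrev DihedralModel (l k : ℕ) [Fact (3 ≤ l)] [Fact (4 ∣ k)] : Type :=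
  Multiplicative (ZMod (2 ^ l)) ⋊[DihedralModel.action l k] DihedralGroup k

/-! ### Multiplication of rotations and reflections in the model -/

namespace DihedralModel

variable {l k : ℕ} [hl : Fact (3 ≤ l)] [hk : Fact (4 ∣ k)]

/-- The element `a ^ i u ^ j`. -/
def R (i : ZMod (2 ^ l)) (j : ZMod k) : DihedralModel l k := ⟨.ofAdd i, .r j⟩

/-- The element `a ^ i v u ^ j`. -/
def S (i : ZMod (2 ^ l)) (j : ZMod k) : DihedralModel l k := ⟨.ofAdd i, .sr j⟩

theorem R_mul_R (i i' : ZMod (2 ^ l)) (j j' : ZMod k) :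
    R i j * R i' j' = R (i + i' * (1 + twist j)) (j + j') := by
  rw [mul_comm i']
  rfl

theorem R_mul_S (i i' : ZMod (2 ^ l)) (j j' : ZMod k) :
    R i j * S i' j' = S (i + i' * (1 + twist j)) (j' - j) := by
  rw [mul_comm i']
  rfl

theorem S_mul_R (i i' : ZMod (2 ^ l)) (j j' : ZMod k) :
    S i j * R i' j' = S (i + i' * (half l - 1 + twist j)) (j + j') := by
  rw [mul_comm i']
  rfl

theorem S_mul_S (i i' : ZMod (2 ^ l)) (j j' : ZMod k) :
    S i j * S i' j' = R (i + i' * (half l - 1 + twist j)) (j' - j) := by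
  rw [mul_comm i']
  rfl

theorem one_eq_R : (1 : DihedralModel l k) = R 0 0 := rfl

theorem R_inj {i i' : ZMod (2 ^ l)} {j j' : ZMod k} : R i j = R i' j' ↔ i = i' ∧ j = j' := by
  simp [R, SemidirectProduct.ext_iff]

theorem S_inj {i i' : ZMod (2 ^ l)} {j j' : ZMod k} : S i j = S i' j' ↔ i = i' ∧ j = j' := by
  simp [S, SemidirectProduct.ext_iff]

theorem S_ne_R (i i' : ZMod (2 ^ l)) (j j' : ZMod k) : S i j ≠ R i' j' := by
  simp [S, R, SemidirectProduct.ext_iff]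

theorem cases_R_S (x : DihedralModel l k) : (∃ i j, x = R i j) ∨ ∃ i j, x = S i j := by
  obtain ⟨i, j | j⟩ := x
  · exact .inl ⟨i.toAdd, j, rfl⟩
  · exact .inr ⟨i.toAdd, j, rfl⟩

theorem R_eq_one {i : ZMod (2 ^ l)} {j : ZMod k} : R i j = 1 ↔ i = 0 ∧ j = 0 := R_inj

theorem R_inv (i : ZMod (2 ^ l)) (j : ZMod k) : (R i j)⁻¹ = R (-i * (1 + twist j)) (-j) := by
  rw [inv_eq_iff_mul_eq_one, R_mul_R, R_eq_one]
  constructor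
  · linear_combination -i * two_mul_twist (l := l) j - i * twist_mul_twist (l := l) j j
  · ring

theorem S_mul_self (i : ZMod (2 ^ l)) (j : ZMod k) :
    S i j * S i j = R (i * (half l + twist j)) 0 := by
  rw [S_mul_S, R_inj]
  constructor <;> ring

/-! ### Simultaneous inversion of commuting elements -/

/-- The equation $gtg=t$ is an inverse-free way of saying that $t$ conjugates $g$ to $g^{-1}$. For
two rotations a reflection serves as $t$. -/
theorem exists_inverting_R_R {i i' : ZMod (2 ^ l)} {j j' : ZMod k}
    (h : Commute (R i j) (R i' j')) :
    ∃ t, R i j * t * R i j = t ∧ R i' j' * t * R i' j' = t := by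
  -- Each summand of the condition is $0$ or $h$, so only parities matter.
  have key : ∀ (i : ZMod (2 ^ l)) (j : ZMod k) (i₀ : ZMod (2 ^ l)) (j₀ : ZMod k),
      i * half l + i₀ * twist j + i * twist j₀ + i * twist j = 0 →
        R i j * S i₀ j₀ * R i j = S i₀ j₀ := by
    intro i j i₀ j₀ h
    rw [R_mul_S, S_mul_R, S_inj, twist_sub]
    constructor
    · linear_combination h
    · ring
  have hc := R_inj.1 (h.eq.trans rfl |>.symm.trans rfl |> fun e => (R_mul_R i' i j' j).symm.trans
    (e.trans (R_mul_R i i' j j')))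
  -- Commuting means that the parity vectors of $(i,j)$ and $(i',j')$ are linearly dependent mod 2.
  have hc1 : i * twist j' = i' * twist j := by linear_combination hc.1
  have e0 : twist (l := l) (0 : ZMod k) = 0 := map_zero _
  have e1 : twist (l := l) (1 : ZMod k) = half l := twist_one
  have hne : half l ≠ 0 := half_ne_zero
  have h2 : half l + half l = 0 := by linear_combination two_mul_half (l := l)
  suffices ∃ (i₀ : ZMod (2 ^ l)) (j₀ : ZMod k),
      (i * half l + i₀ * twist j + i * twist j₀ + i * twist j = 0) ∧
      (i' * half l + i₀ * twist j' + i' * twist j₀ + i' * twist j' = 0) by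
    obtain ⟨i₀, j₀, h1, h2⟩ := this
    exact ⟨S i₀ j₀, key _ _ _ _ h1, key _ _ _ _ h2⟩
  rcases half_mul_cases i with hi | hi <;> rcases half_mul_cases i' with hi' | hi' <;>
  rcases twist_cases (l := l) j with hj | hj <;> rcases twist_cases (l := l) j' with hj' | hj' <;>
  rw [mul_comm] at hi hi' <;> simp only [hj, hj', hi, hi', mul_zero] at hc1 ⊢
  -- Dependent parity vectors leave cases solved by $t=v$ or $t=vu$; the others contradict `hc1`.
  all_goals first
    | exact absurd hc1 hne
    | exact absurd hc1.symm hne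
    | (refine ⟨0, 0, ?_, ?_⟩ <;> (simp [e0, h2]; done))
    | (refine ⟨0, 1, ?_, ?_⟩ <;> simp [e1, hi, hi', h2])

theorem of_commute_S_R [NeZero k] {i i' : ZMod (2 ^ l)} {j j' : ZMod k}
    (h : Commute (S i j) (R i' j')) : 2 * i' = 0 ∧ 2 * j' = 0 ∧ twist (l := l) j' = 0 := by
  have h0 := h.eq
  rw [S_mul_R, R_mul_S, S_inj] at h0
  have h2 : 2 * j' = 0 := by linear_combination h0.2
  have h3 := twist_eq_zero_of_two_mul (l := l) h2
  refine ⟨?_, h2, h3⟩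
  have h4 := h0.1
  rw [h3] at h4
  -- The relation is $i'(h-2)=0$ or $i'(2h-2)=0$; multiplying the former by $-(1+q)$ gives $2i'=0$.
  rcases twist_cases (l := l) j with hj | hj <;> rw [hj] at h4
  · linear_combination -(1 + quarter l) * h4 + i' * half_eq (l := l) +
      i' * half_mul_quarter (l := l)
  · linear_combination -h4 + i' * two_mul_half (l := l)

theorem half_mul_eq_zero_of_two_mul {i : ZMod (2 ^ l)} (h : 2 * i = 0) : half l * i = 0 := by
  linear_combination i * half_eq (l := l) + quarter l * h

theorem exists_inverting_S (i : ZMod (2 ^ l)) (j : ZMod k) :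
    ∃ x : ZMod (2 ^ l), S i j * R x 0 * S i j = R x 0 := by
  suffices ∃ x : ZMod (2 ^ l), i * (half l + twist j) + x * (half l - 2 + twist j) = 0 by
    obtain ⟨x, hx⟩ := this
    refine ⟨x, ?_⟩
    rw [S_mul_R, S_mul_S, R_inj, map_add, map_zero]
    constructor
    · linear_combination hx
    · ring
  rcases twist_cases (l := l) j with hj | hj <;> rw [hj]
  · rcases half_mul_cases i with hi | hi
    · exact ⟨0, by linear_combination hi⟩
    -- Here $q(h-2)=-h$, which cancels $ih=h$.
    · refine ⟨quarter l, ?_⟩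
      linear_combination hi + half_mul_quarter (l := l) + half_eq (l := l)
  · exact ⟨0, by linear_combination i * two_mul_half (l := l)⟩

/-- A rotation commuting with a reflection squares to 1 and commutes with all powers of $a$, so any
`R x 0` inverts it. Only the reflection constrains $x$. -/
theorem exists_inverting_S_R [NeZero k] {i i' : ZMod (2 ^ l)} {j j' : ZMod k}
    (h : Commute (S i j) (R i' j')) :
    ∃ t, S i j * t * S i j = t ∧ R i' j' * t * R i' j' = t := by
  obtain ⟨h1, h2, h3⟩ := of_commute_S_R h
  obtain ⟨x, hx⟩ := exists_inverting_S i j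
  refine ⟨R x 0, hx, ?_⟩
  rw [R_mul_R, R_mul_R, R_inj, map_add, map_zero, h3]
  constructor
  · linear_combination h1
  · linear_combination h2

theorem exists_inverting [NeZero k] {g g' : DihedralModel l k} (h : Commute g g') :
    ∃ t, g * t * g = t ∧ g' * t * g' = t := by
  rcases cases_R_S g with ⟨i, j, rfl⟩ | ⟨i, j, rfl⟩ <;>
    rcases cases_R_S g' with ⟨i', j', rfl⟩ | ⟨i', j', rfl⟩
  · exact exists_inverting_R_R h
  · obtain ⟨t, h1, h2⟩ := exists_inverting_S_R h.symm
    exact ⟨t, h2, h1⟩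
  · exact exists_inverting_S_R h
  -- For commuting reflections $g,g'$, the product $gg'$ is a rotation commuting with $g$. Inverting
  -- $g$ and $gg'$ forces inverting $g'$.
  · have h3 : Commute (S i j) (S i j * S i' j') := (Commute.refl _).mul_right h
    have h4 : S i j * S i' j' = R (i + i' * (half l - 1 + twist j)) (j' - j) := S_mul_S ..
    rw [h4] at h3
    obtain ⟨t, h1, h2⟩ := exists_inverting_S_R h3
    refine ⟨t, h1, ?_⟩
    rw [← h4] at h2
    have h5 : S i j * (S i' j' * t * S i' j') * S i j = S i j * t * S i j := by
      calc S i j * (S i' j' * t * S i' j') * S i j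
          = S i j * S i' j' * t * (S i' j' * S i j) := by simp only [mul_assoc]
        _ = S i j * t * S i j := by rw [← h.eq, h2, h1]
    exact mul_left_cancel (mul_right_cancel h5)

/-! ### Generation by involutions -/

/-- The square of `S i j` is $a^{i(h+\mathrm{twist}\,j)}$, so all $vu^j$ are involutions, and so are
all $a^ivu$ because $h+\mathrm{twist}\,1=2h=0$. Products of these give every rotation. -/
theorem closure_orderOf_eq_two :
    Subgroup.closure {g : DihedralModel l k | orderOf g = 2} = ⊤ := by
  have hS : ∀ (i : ZMod (2 ^ l)) (j : ZMod k), i * (half l + twist j) = 0 →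
      S i j ∈ Subgroup.closure {g : DihedralModel l k | orderOf g = 2} := by
    intro i j h
    refine Subgroup.subset_closure (orderOf_eq_prime ?_ (S_ne_R _ _ _ _))
    rw [pow_two, S_mul_self, h, one_eq_R]
  have hS0 := fun j => hS 0 j (zero_mul _)
  have hS1 := fun i => hS i 1 (by rw [twist_one, ← two_mul, two_mul_half, mul_zero])
  have hR : ∀ i j, R i j ∈ Subgroup.closure {g : DihedralModel l k | orderOf g = 2} := by
    intro i j
    have : R i j = S i 1 * S 0 (j + 1) := by rw [S_mul_S, R_inj]; constructor <;> ring
    rw [this]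
    exact mul_mem (hS1 _) (hS0 _)
  refine eq_top_iff.2 fun x _ => ?_
  rcases cases_R_S x with ⟨i, j, rfl⟩ | ⟨i, j, rfl⟩
  · exact hR i j
  · have : S i j = R i 0 * S 0 j := by rw [R_mul_S, S_inj]; constructor <;> ring
    rw [this]
    exact mul_mem (hR _ _) (hS0 _)

/-! ### An abelian normal subgroup with abelian quotient -/

variable (l k) in
/-- The subgroup generated by `a` and `u ^ 2`. -/
def base : Subgroup (DihedralModel l k) where
  carrier := {x | ∃ i j, twist (l := l) j = 0 ∧ x = R i j}
  one_mem' := ⟨0, 0, map_zero _, rfl⟩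
  mul_mem' := by
    rintro _ _ ⟨i, j, hj, rfl⟩ ⟨i', j', hj', rfl⟩
    exact ⟨_, _, by rw [map_add, hj, hj', add_zero], R_mul_R _ _ _ _⟩
  inv_mem' := by
    rintro _ ⟨i, j, hj, rfl⟩
    exact ⟨_, _, by rw [twist_neg, hj], R_inv _ _⟩

theorem R_mem_base {i : ZMod (2 ^ l)} {j : ZMod k} : R i j ∈ base l k ↔ twist (l := l) j = 0 := by
  constructor
  · rintro ⟨i', j', h, h'⟩
    rwa [(R_inj.1 h').2]
  · exact fun h => ⟨i, j, h, rfl⟩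

theorem commute_of_mem_base {x y : DihedralModel l k} (hx : x ∈ base l k) (hy : y ∈ base l k) :
    x * y = y * x := by
  obtain ⟨i, j, hj, rfl⟩ := hx
  obtain ⟨i', j', hj', rfl⟩ := hy
  rw [R_mul_R, R_mul_R, hj, hj', R_inj]
  constructor <;> ring

/-- The quotient by `base` is a Klein four-group generated by the images of $u$ and $v$. -/
theorem commutator_mem_base (x y : DihedralModel l k) :
    x * y * x⁻¹ * y⁻¹ ∈ base l k := by
  have h : ∃ b ∈ base l k, x * y = b * (y * x) := by
    rcases cases_R_S x with ⟨i, j, rfl⟩ | ⟨i, j, rfl⟩ <;>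
      rcases cases_R_S y with ⟨i', j', rfl⟩ | ⟨i', j', rfl⟩ <;>
      simp only [R_mul_R, R_mul_S, S_mul_R, S_mul_S]
    · exact ⟨R (i + i' * (1 + twist j) - (i' + i * (1 + twist j'))) 0,
        R_mem_base.2 (map_zero _), by rw [R_mul_R, R_inj, map_zero]; constructor <;> ring⟩
    · refine ⟨R (i + i' * (1 + twist j) - (i' + i * (half l - 1 + twist j'))) (2 * j),
        R_mem_base.2 ?_, ?_⟩
      · rw [two_mul, map_add, ← two_mul, two_mul_twist]
      · rw [R_mul_S, S_inj, two_mul, map_add, ← two_mul, two_mul_twist]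
        constructor <;> ring
    · refine ⟨R (i + i' * (half l - 1 + twist j) - (i' + i * (1 + twist j'))) (-(2 * j')),
        R_mem_base.2 ?_, ?_⟩
      · rw [twist_neg, two_mul, map_add, ← two_mul, two_mul_twist]
      · rw [R_mul_S, S_inj, twist_neg, two_mul, map_add, ← two_mul, two_mul_twist]
        constructor <;> ring
    · refine ⟨R (i + i' * (half l - 1 + twist j) - (i' + i * (half l - 1 + twist j')))
        (2 * (j' - j)), R_mem_base.2 ?_, ?_⟩
      · rw [two_mul, map_add, ← two_mul, two_mul_twist]
      · rw [R_mul_R, R_inj, two_mul, map_add, ← two_mul, two_mul_twist]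
        constructor <;> ring
  obtain ⟨b, hb, h⟩ := h
  rw [h]
  simpa [mul_assoc] using hb

/-- A subgroup containing `base` is inverted, modulo its commutators, by an element of order at
most two. -/
theorem exists_inverting_mod_commutator {K : Subgroup (DihedralModel l k)} (hK : base l k ≤ K) :
    ∃ t : DihedralModel l k, t * t = 1 ∧ ∀ x ∈ K, t * x * t⁻¹ * x ∈ ⁅K, K⁆ := by
  have hR : ∀ i, R i 0 ∈ K := fun i => hK (R_mem_base.2 (map_zero _))
  -- If $K$ contains a reflection, then $a^2\in[K,K]$ and all squares of $K$ lie in $[K,K]$, so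
  -- $t=1$ works. Otherwise $K\le\langle a,u\rangle$, and $vu$ inverts both $a$ and $u$.
  by_cases h : ∃ i j, S i j ∈ K
  · obtain ⟨i₀, j₀, hs⟩ := h
    have hcomm : ∀ x y : DihedralModel l k, x ∈ K → y ∈ K → ∀ b, x * y = b * (y * x) →
        b ∈ ⁅K, K⁆ := by
      intro x y hx hy b hb
      have := Subgroup.commutator_mem_commutator hx hy
      rwa [commutatorElement_def, hb, show b * (y * x) * x⁻¹ * y⁻¹ = b by group] at this
    have h2 : ∀ i, R (2 * i) 0 ∈ ⁅K, K⁆ := by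
      intro i
      rcases twist_cases (l := l) j₀ with hj | hj
      -- The exponent $y$ is chosen to solve $y(h-2)=2i$.
      · refine hcomm _ _ hs (hR (-i * (1 + quarter l))) _ ?_
        rw [S_mul_R, R_mul_S, R_mul_S, S_inj, map_zero, hj]
        constructor
        · linear_combination i * half_mul_quarter (l := l) * (-1) - i * half_eq (l := l)
        · ring
      · refine hcomm _ _ hs (hR (-i)) _ ?_
        rw [S_mul_R, R_mul_S, R_mul_S, S_inj, map_zero, hj]
        constructor
        · linear_combination -i * two_mul_half (l := l)
        · ring
    have hhalf : ∀ i, half l * i = 2 * (quarter l * i) := fun i => by rw [half_eq]; ring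
    refine ⟨1, one_mul 1, fun x hx => ?_⟩
    rw [one_mul, inv_one, mul_one]
    rcases cases_R_S x with ⟨i, j, rfl⟩ | ⟨i, j, rfl⟩
    · have htw : ∀ (y : ZMod (2 ^ l)) (j' : ZMod k), ∃ e, y * twist j' = 2 * e := fun y j' => by
        rcases twist_cases (l := l) j' with hj | hj <;> rw [hj]
        · exact ⟨0, by ring⟩
        · exact ⟨_, (mul_comm _ _).trans (hhalf y)⟩
      obtain ⟨e₁, he₁⟩ := htw (i₀ + i) j
      obtain ⟨e₂, he₂⟩ := htw i j₀
      have h2j : twist (l := l) (2 * j) = 0 := by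
        rw [two_mul, map_add, ← two_mul, two_mul_twist]
      -- This commutator of $x$ with the reflection has the same $u$-part as $x^2$, and they differ
      -- by an even power of $a$, already known to lie in $[K,K]$.
      have hb := hcomm _ _ hx hs
        (R (2 * i + i₀ * twist j - i * half l - i * twist j₀) (2 * j)) (by
          rw [S_mul_R, R_mul_S, R_mul_S, S_inj, h2j]
          constructor <;> ring)
      refine (Subgroup.mul_mem_cancel_left _ (inv_mem hb)).1 ?_
      rw [R_mul_R, R_inv, R_mul_R, twist_neg, h2j]
      convert h2 (quarter l * i + e₂ + e₁ - i₀ * twist j) using 1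
      rw [R_inj]
      constructor
      · linear_combination he₁ + he₂ + hhalf i
      · ring
    · rw [S_mul_self]
      rcases twist_cases (l := l) j with hj | hj <;> rw [hj]
      · rw [add_zero, mul_comm, hhalf]
        exact h2 _
      · rw [← two_mul, mul_comm, mul_assoc]
        exact h2 _
  · refine ⟨S 0 1, ?_, fun x hx => ?_⟩
    · rw [S_mul_self, zero_mul, one_eq_R]
    · rcases cases_R_S x with ⟨i, j, rfl⟩ | ⟨i, j, rfl⟩
      · have h1 : (S 0 1 : DihedralModel l k)⁻¹ = S 0 1 := by
          rw [inv_eq_iff_mul_eq_one, S_mul_self, zero_mul, one_eq_R]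
        have hj : (R 0 j : DihedralModel l k) ∈ K := by
          have := mul_mem (hR (-i)) hx
          rw [R_mul_R, map_zero] at this
          convert this using 2 <;> ring
        have := Subgroup.commutator_mem_commutator (hR i) hj
        rw [commutatorElement_def] at this
        convert this using 1
        simp only [h1, S_mul_R, S_mul_S, R_mul_R, R_inv, R_inj, map_sub, map_add, map_neg, map_zero,
          twist_one]
        constructor
        · linear_combination i * two_mul_half (l := l)
        · ring
      · exact absurd ⟨i, j, hx⟩ h

end DihedralModel

namespace DihedralModel

/-! ### The presentation -/

section Presented

variable (l k : ℕ)

/-- The generator `a` of the presented group. -/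
def presA : DihedralExt l k := PresentedGroup.of .a
/-- The generator `u` of the presented group. -/
def presU : DihedralExt l k := PresentedGroup.of .u
/-- The generator `v` of the presented group. -/
def presV : DihedralExt l k := PresentedGroup.of .v

theorem presA_pow : presA l k ^ 2 ^ l = 1 :=
  PresentedGroup.one_of_mem (rels := dihedralExtRels l k) (by simp [dihedralExtRels])

theorem presU_pow : presU l k ^ k = 1 :=
  PresentedGroup.one_of_mem (rels := dihedralExtRels l k) (by simp [dihedralExtRels])

theorem presV_sq : presV l k ^ 2 = 1 :=
  PresentedGroup.one_of_mem (rels := dihedralExtRels l k) (by simp [dihedralExtRels])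

theorem presU_conj_presA :
    presU l k * presA l k * (presU l k)⁻¹ = presA l k ^ (2 ^ (l - 1) + 1) :=
  mul_inv_eq_one.1 <|
    PresentedGroup.one_of_mem (rels := dihedralExtRels l k) (by simp [dihedralExtRels])

theorem presV_conj_presA :
    presV l k * presA l k * presV l k = presA l k ^ (2 ^ (l - 1) - 1) :=
  mul_inv_eq_one.1 <|
    PresentedGroup.one_of_mem (rels := dihedralExtRels l k) (by simp [dihedralExtRels])

theorem presV_conj_presU : presV l k * presU l k * presV l k = (presU l k)⁻¹ :=
  mul_inv_eq_one.1 <|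
    PresentedGroup.one_of_mem (rels := dihedralExtRels l k) (by simp [dihedralExtRels])

variable {l k}

theorem presU_mul_presA_pow (i : ℕ) :
    presU l k * presA l k ^ i = presA l k ^ ((2 ^ (l - 1) + 1) * i) * presU l k := by
  rw [pow_mul, ← presU_conj_presA, conj_pow, inv_mul_cancel_right]

theorem presV_mul_self : presV l k * presV l k = 1 := by
  rw [← pow_two, presV_sq]

theorem presV_mul_presA_pow (i : ℕ) :
    presV l k * presA l k ^ i = presA l k ^ ((2 ^ (l - 1) - 1) * i) * presV l k := by
  have h : (presV l k)⁻¹ = presV l k := inv_eq_of_mul_eq_one_left presV_mul_self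
  rw [pow_mul, ← presV_conj_presA]
  nth_rewrite 3 [← h]
  rw [conj_pow, h, mul_assoc, mul_assoc, presV_mul_self, mul_one]

theorem presU_mul_presV (hk : 0 < k) :
    presU l k * presV l k = presV l k * presU l k ^ (k - 1) := by
  have h : presU l k ^ (k - 1) = (presU l k)⁻¹ := by
    rw [eq_inv_iff_mul_eq_one, ← pow_succ, Nat.sub_add_cancel hk, presU_pow]
  rw [h, ← presV_conj_presU]
  simp only [← mul_assoc, presV_mul_self, one_mul]

/-- Every element of the presented group is of the form `a ^ i u ^ j` or `a ^ i v u ^ j`. -/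
theorem exists_normal_form (hk : 0 < k) (x : DihedralExt l k) :
    ∃ i j : ℕ, x = presA l k ^ i * presU l k ^ j ∨
      x = presA l k ^ i * presV l k * presU l k ^ j := by
  set P : DihedralExt l k → Prop := fun x => ∃ i j : ℕ, x = presA l k ^ i * presU l k ^ j ∨
      x = presA l k ^ i * presV l k * presU l k ^ j with hP
  have hA : ∀ x, P x → P (presA l k * x) := by
    rintro _ ⟨i, j, rfl | rfl⟩
    · exact ⟨i + 1, j, .inl (by rw [pow_succ', mul_assoc])⟩
    · exact ⟨i + 1, j, .inr (by simp only [pow_succ', mul_assoc])⟩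
  have hU : ∀ x, P x → P (presU l k * x) := by
    rintro _ ⟨i, j, rfl | rfl⟩
    · exact ⟨(2 ^ (l - 1) + 1) * i, j + 1, .inl (by
        rw [← mul_assoc, presU_mul_presA_pow, mul_assoc, pow_succ'])⟩
    · exact ⟨(2 ^ (l - 1) + 1) * i, k - 1 + j, .inr (by
        rw [← mul_assoc, ← mul_assoc, presU_mul_presA_pow, mul_assoc (_ ^ _), presU_mul_presV hk,
          pow_add]
        simp only [mul_assoc])⟩
  have hV : ∀ x, P x → P (presV l k * x) := by
    rintro _ ⟨i, j, rfl | rfl⟩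
    · exact ⟨(2 ^ (l - 1) - 1) * i, j, .inr (by rw [← mul_assoc, presV_mul_presA_pow])⟩
    · exact ⟨(2 ^ (l - 1) - 1) * i, j, .inl (by
        rw [← mul_assoc, ← mul_assoc, presV_mul_presA_pow, mul_assoc (_ ^ _), presV_mul_self,
          mul_one])⟩
  have hpow : ∀ y : DihedralExt l k, (∀ x, P x → P (y * x)) → ∀ m : ℕ, ∀ x, P x → P (y ^ m * x) := by
    intro y hy m
    induction m with
    | zero => simp
    | succ m ih =>
      intro x hx
      rw [pow_succ', mul_assoc]
      exact hy _ (ih x hx)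
  -- Each generator has finite order, so its inverse is one of its nonnegative powers.
  have hinv : ∀ (y : DihedralExt l k) (m : ℕ), 0 < m → y ^ m = 1 → (∀ x, P x → P (y * x)) →
      ∀ x, P x → P (y⁻¹ * x) := by
    intro y m hm h hy
    have : y⁻¹ = y ^ (m - 1) := by
      rw [eq_comm, eq_inv_iff_mul_eq_one, ← pow_succ, Nat.sub_add_cancel hm, h]
    rw [this]
    exact hpow y hy _
  obtain ⟨y, rfl⟩ := PresentedGroup.mk_surjective _ x
  suffices ∀ x, P x → P (PresentedGroup.mk _ y * x) by
    simpa using this 1 ⟨0, 0, .inl (by simp)⟩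
  induction y using FreeGroup.induction_on with
  | C1 => simp
  | of g =>
    cases g
    exacts [hA, hU, hV]
  | inv_of g _ =>
    rw [map_inv]
    cases g
    exacts [hinv _ _ (by positivity) (presA_pow l k) hA, hinv _ _ hk (presU_pow l k) hU,
      hinv _ _ two_pos (presV_sq l k) hV]
  | mul a b ha hb =>
    intro x hx
    rw [map_mul, mul_assoc]
    exact ha _ (hb x hx)

end Presented

theorem natCast_half_add_one {l : ℕ} :
    ((2 ^ (l - 1) + 1 : ℕ) : ZMod (2 ^ l)) = half l + 1 := by
  push_cast
  rfl

theorem natCast_half_sub_one {l : ℕ} :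
    ((2 ^ (l - 1) - 1 : ℕ) : ZMod (2 ^ l)) = half l - 1 := by
  rw [Nat.cast_sub Nat.one_le_two_pow]
  push_cast
  rfl

theorem isUnit_natCast_of_odd {l m : ℕ} (hm : Odd m) : IsUnit (m : ZMod (2 ^ l)) :=
  (ZMod.isUnit_iff_coprime m (2 ^ l)).2 (Nat.Coprime.pow_right l hm.coprime_two_right)

theorem isUnit_natCast_add_two_mul {l m : ℕ} (hm : Odd m) (y : ZMod (2 ^ l)) :
    IsUnit ((m : ZMod (2 ^ l)) + 2 * y) := by
  obtain ⟨t, rfl⟩ := ZMod.natCast_zmod_surjective y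
  have := isUnit_natCast_of_odd (l := l) (hm.add_even (even_two_mul t))
  push_cast at this
  exact this

/-- This reindexing removes odd factors from the exponents of $a$ in the sums over $m$-th powers. -/
theorem sum_isUnit_mul {l : ℕ} {A : Type*} [AddCommMonoid A] {c : ZMod (2 ^ l)} (hc : IsUnit c)
    (f : ZMod (2 ^ l) → A) : ∑ i, f (c * i) = ∑ i, f i := by
  obtain ⟨c, rfl⟩ := hc
  exact Equiv.sum_comp (Units.mulLeft c) f

variable {l k : ℕ} [hl : Fact (3 ≤ l)] [hk : Fact (4 ∣ k)]

theorem R_one_zero_pow (m : ℕ) : (R 1 0 : DihedralModel l k) ^ m = R m 0 := by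
  induction m with
  | zero => rw [pow_zero, Nat.cast_zero, one_eq_R]
  | succ m ih =>
    rw [pow_succ, ih, R_mul_R, R_inj, map_zero]
    push_cast
    constructor <;> ring

theorem R_zero_one_pow (m : ℕ) : (R 0 1 : DihedralModel l k) ^ m = R 0 m := by
  induction m with
  | zero => rw [pow_zero, Nat.cast_zero, one_eq_R]
  | succ m ih =>
    rw [pow_succ, ih, R_mul_R, R_inj]
    push_cast
    constructor <;> ring

open DihedralExtGen in
/-- The images of the generators in the model. -/
def gen : DihedralExtGen → DihedralModel l k
  | a => R 1 0
  | u => R 0 1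
  | v => S 0 0

theorem lift_gen_eq_one : ∀ r ∈ dihedralExtRels l k,
    FreeGroup.lift (gen (l := l) (k := k)) r = 1 := by
  have hS : ∀ i : ZMod (2 ^ l), ∀ j : ZMod k, i * (half l + twist j) = 0 →
      S i j * S i j = 1 := by
    intro i j h
    rw [S_mul_self, h, one_eq_R]
  intro r hr
  simp only [dihedralExtRels, Set.mem_insert_iff, Set.mem_singleton_iff] at hr
  rcases hr with rfl | rfl | rfl | rfl | rfl | rfl <;>
    simp only [map_mul, map_pow, map_inv, FreeGroup.lift_apply_of, gen, R_one_zero_pow,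
      R_zero_one_pow, mul_inv_eq_one, inv_inv]
  · rw [R_eq_one]
    exact ⟨ZMod.natCast_self _, rfl⟩
  · rw [R_eq_one]
    exact ⟨rfl, ZMod.natCast_self _⟩
  · rw [pow_two, hS _ _ (zero_mul _)]
  · rw [natCast_half_add_one, R_inv, R_mul_R, R_mul_R, R_inj, map_add, map_zero, twist_one]
    constructor <;> ring
  · rw [natCast_half_sub_one, S_mul_R, S_mul_S, R_inj, map_add, map_zero]
    constructor <;> ring
  · rw [S_mul_R, S_mul_S, R_mul_R, R_eq_one, map_add, map_zero]
    constructor <;> ring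

/-- The homomorphism from the presented group to the model. -/
def ofPresented : DihedralExt l k →* DihedralModel l k :=
  PresentedGroup.toGroup lift_gen_eq_one

/-- The normal form bounds the presented group from above. Its image `R i j` or `S i j` determines
$i$ mod $2^l$ and $j$ mod $k$, so nothing collapses. -/
theorem ofPresented_bijective [NeZero k] :
    Function.Bijective (ofPresented (l := l) (k := k)) := by
  have hA : ofPresented (presA l k) = R 1 0 := PresentedGroup.toGroup.of lift_gen_eq_one
  have hU : ofPresented (presU l k) = R 0 1 := PresentedGroup.toGroup.of lift_gen_eq_one
  have hV : ofPresented (presV l k) = S 0 0 := PresentedGroup.toGroup.of lift_gen_eq_one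
  have h1 : ∀ i j : ℕ, ofPresented (presA l k ^ i * presU l k ^ j) = R i j := by
    intro i j
    rw [map_mul, map_pow, map_pow, hA, hU, R_one_zero_pow, R_zero_one_pow, R_mul_R, R_inj]
    constructor <;> ring
  have h2 : ∀ i j : ℕ, ofPresented (presA l k ^ i * presV l k * presU l k ^ j) = S i j := by
    intro i j
    rw [map_mul, map_mul, map_pow, map_pow, hA, hU, hV, R_one_zero_pow, R_zero_one_pow, R_mul_S,
      S_mul_R, S_inj]
    constructor <;> ring
  constructor
  · rw [injective_iff_map_eq_one]
    intro x hx
    obtain ⟨i, j, rfl | rfl⟩ := exists_normal_form (NeZero.pos k) x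
    · rw [h1, R_eq_one, ZMod.natCast_eq_zero_iff, ZMod.natCast_eq_zero_iff] at hx
      obtain ⟨⟨c, rfl⟩, ⟨d, rfl⟩⟩ := hx
      rw [pow_mul, pow_mul, presA_pow, presU_pow, one_pow, one_pow, one_mul]
    · rw [h2] at hx
      exact absurd hx (S_ne_R _ _ _ _)
  · intro x
    rcases cases_R_S x with ⟨i, j, rfl⟩ | ⟨i, j, rfl⟩ <;>
      obtain ⟨i, rfl⟩ := ZMod.natCast_zmod_surjective i <;>
      obtain ⟨j, rfl⟩ := ZMod.natCast_zmod_surjective j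
    · exact ⟨_, h1 i j⟩
    · exact ⟨_, h2 i j⟩

/-- The presented group is isomorphic to the model. -/
def presentedEquiv [NeZero k] : DihedralExt l k ≃* DihedralModel l k :=
  MulEquiv.ofBijective _ ofPresented_bijective

instance [NeZero k] : Finite (DihedralModel l k) :=
  Finite.of_equiv _ SemidirectProduct.equivProd.symm

theorem card_eq [NeZero k] : Nat.card (DihedralModel l k) = 2 ^ l * (2 * k) := by
  rw [SemidirectProduct.card, DihedralGroup.nat_card]
  simp

/-! ### Traces of power sums -/

variable {V : Type*} [AddCommGroup V] [Module ℂ V] [FiniteDimensional ℂ V]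

open scoped ComplexOrder in
/-- The sum of the character values of a representation of a finite group is nonnegative. -/
theorem _root_.MonoidHom.sum_trace_nonneg {Q : Type*} [Group Q] [Fintype Q]
    (ρ : Q →* Module.End ℂ V) : 0 ≤ ∑ q, LinearMap.trace ℂ V (ρ q) := by
  have h0 : (Nat.card Q : ℂ) ≠ 0 := by simp
  have : Invertible (Nat.card Q : ℂ) := invertibleOfNonzero h0
  have h := Representation.card_inv_mul_sum_char_eq_finrank (ρ : Representation ℂ Q V)
  rw [inv_mul_eq_iff_eq_mul₀ h0] at h
  show 0 ≤ ∑ q, Representation.character (ρ : Representation ℂ Q V) q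
  rw [h]
  exact_mod_cast Nat.zero_le _

theorem sum_eq [NeZero k] [Fintype (DihedralModel l k)] {A : Type*} [AddCommMonoid A]
    (f : DihedralModel l k → A) :
    ∑ x, f x = ∑ i, ∑ j, f (R i j) + ∑ i, ∑ j, f (S i j) := by
  rw [← Finset.sum_add_distrib]
  have e : DihedralModel l k ≃ ZMod (2 ^ l) × (ZMod k ⊕ ZMod k) :=
    SemidirectProduct.equivProd.trans (Multiplicative.toAdd.prodCongr DihedralGroup.equivSum)
  rw [← Equiv.sum_comp (SemidirectProduct.equivProd.trans
    (Multiplicative.toAdd.prodCongr DihedralGroup.equivSum)).symm, Fintype.sum_prod_type]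
  refine Finset.sum_congr rfl fun i _ => ?_
  rw [Fintype.sum_sum_type]
  rfl

/-- Since products of twists vanish, $\sum_{s<m}(1+\mathrm{twist}\,j)^s=m+\binom
m2\,\mathrm{twist}\,j$. -/
theorem R_pow (i : ZMod (2 ^ l)) (j : ZMod k) (m : ℕ) :
    R i j ^ m = R (((m : ZMod (2 ^ l)) + (m.choose 2 : ZMod (2 ^ l)) * twist j) * i) ((m : ZMod k) * j) := by
  induction m with
  | zero => simp [one_eq_R]
  | succ m ih =>
    rw [pow_succ, ih, R_mul_R, R_inj, twist_natCast_mul, Nat.choose_succ_succ' m 1, Nat.choose_one_right]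
    push_cast
    constructor <;> ring

theorem S_pow_two_mul (i : ZMod (2 ^ l)) (j : ZMod k) (m : ℕ) :
    S i j ^ (2 * m) = R (i * ((half l + twist j) * (m : ZMod (2 ^ l)))) 0 := by
  rw [pow_mul, pow_two, S_mul_self, R_pow, R_inj, map_zero]
  constructor <;> ring

/-- Divisibility of $h$ by 4 (from $l\ge3$) matters: after extracting a factor 2 from an exponent,
the twist still contributes an even number, so the cofactor remains a unit. -/
theorem twist_eq_two_mul (j : ZMod k) : ∃ y, twist (l := l) j = 2 * (2 * y) := by
  rcases twist_cases (l := l) j with h | h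
  · exact ⟨0, by rw [h]; ring⟩
  · refine ⟨2 ^ (l - 3), ?_⟩
    have := hl.out
    rw [h, half, ← pow_succ', ← pow_succ']
    congr 1
    omega

variable (k) in
/-- The homomorphism `i ↦ a ^ (c i)`. -/
def mulHom (c : ZMod (2 ^ l)) : Multiplicative (ZMod (2 ^ l)) →* DihedralModel l k where
  toFun i := R (c * i.toAdd) 0
  map_one' := by rw [toAdd_one, mul_zero, one_eq_R]
  map_mul' i i' := by
    rw [R_mul_R, R_inj, map_zero, toAdd_mul]
    constructor <;> ring

/-- The homomorphism `(i, j) ↦ a ^ (c i) u ^ (m j)`, for even `m`. -/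
def mulHomProd (c : ZMod (2 ^ l)) {m : ℕ} (hm : Even m) :
    Multiplicative (ZMod (2 ^ l) × ZMod k) →* DihedralModel l k where
  toFun x := R (c * x.toAdd.1) ((m : ZMod k) * x.toAdd.2)
  map_one' := by rw [toAdd_one, Prod.fst_zero, Prod.snd_zero, mul_zero, mul_zero, one_eq_R]
  map_mul' x y := by
    obtain ⟨d, rfl⟩ := hm
    rw [R_mul_R, R_inj, twist_natCast_mul, toAdd_mul, Prod.fst_add, Prod.snd_add]
    push_cast
    constructor
    · linear_combination -d * c * (y.toAdd.1) * two_mul_twist (l := l) x.toAdd.2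
    · ring

/-- The endomorphism fixing `a` and `v`, and sending `u` to `u ^ m`, for odd `m`. -/
def powHom {m : ℕ} (hm : Odd m) : DihedralModel l k →* DihedralModel l k where
  toFun x := ⟨x.left, match x.right with
    | .r j => .r ((m : ZMod k) * j)
    | .sr j => .sr ((m : ZMod k) * j)⟩
  map_one' := by
    show R 0 ((m : ZMod k) * 0) = R 0 0
    rw [mul_zero]
  map_mul' x y := by
    have h : ∀ j : ZMod k, twist (l := l) ((m : ZMod k) * j) = twist j := by
      intro j
      obtain ⟨c, rfl⟩ := hm
      rw [twist_natCast_mul]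
      push_cast
      linear_combination c * two_mul_twist (l := l) j
    rcases cases_R_S x with ⟨i, j, rfl⟩ | ⟨i, j, rfl⟩ <;>
      rcases cases_R_S y with ⟨i', j', rfl⟩ | ⟨i', j', rfl⟩ <;>
      simp only [R_mul_R, R_mul_S, S_mul_R, S_mul_S]
    · show R _ ((m : ZMod k) * _) = R i ((m : ZMod k) * j) * R i' ((m : ZMod k) * j')
      rw [R_mul_R, h, mul_add (m : ZMod k)]
    · show S _ ((m : ZMod k) * _) = R i ((m : ZMod k) * j) * S i' ((m : ZMod k) * j')
      rw [R_mul_S, h, mul_sub]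
    · show S _ ((m : ZMod k) * _) = S i ((m : ZMod k) * j) * R i' ((m : ZMod k) * j')
      rw [S_mul_R, h, mul_add (m : ZMod k)]
    · show R _ ((m : ZMod k) * _) = S i ((m : ZMod k) * j) * S i' ((m : ZMod k) * j')
      rw [S_mul_S, h, mul_sub]

open scoped ComplexOrder in
-- Rotations and reflections are treated separately; in each case the powers, suitably reindexed,
-- are the values of homomorphisms from abelian groups.
theorem sum_trace_pow_nonneg_of_even [NeZero k] [Fintype (DihedralModel l k)]
    (ρ : DihedralModel l k →* Module.End ℂ V) {m : ℕ} (hm : Even m) :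
    0 ≤ ∑ x, LinearMap.trace ℂ V (ρ (x ^ m)) := by
  rw [sum_eq]
  refine add_nonneg ?_ ?_
  · suffices ∃ c : ZMod (2 ^ l), ∀ j : ZMod k, ∑ i, LinearMap.trace ℂ V (ρ (R i j ^ m)) =
        ∑ i, LinearMap.trace ℂ V (ρ (R (c * i) ((m : ZMod k) * j))) by
      obtain ⟨c, hc⟩ := this
      rw [Finset.sum_comm]
      simp only [hc]
      rw [Finset.sum_comm, ← Fintype.sum_prod_type']
      refine (MonoidHom.sum_trace_nonneg (ρ.comp (mulHomProd c hm))).trans_eq ?_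
      exact Fintype.sum_equiv Multiplicative.toAdd _ _ fun _ => rfl
    obtain ⟨d, rfl⟩ := hm
    rw [← two_mul]
    rcases Nat.even_or_odd d with hd | hd
    · obtain ⟨e, rfl⟩ := hd
      -- For $m=2d$ with $d$ even, $\binom m2$ is even and kills the twist.
      refine ⟨((2 * (e + e) : ℕ) : ZMod (2 ^ l)), fun j => Finset.sum_congr rfl fun i _ => ?_⟩
      have h1 : (2 * (e + e)).choose 2 = 2 * (e * (2 * (e + e) - 1)) := by
        rw [Nat.choose_two_right]
        apply Nat.div_eq_of_eq_mul_left two_pos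
        ring
      rw [R_pow, h1]
      congr 3
      push_cast
      linear_combination
        (e : ZMod (2 ^ l)) * ((2 * (e + e) - 1 : ℕ) : ZMod (2 ^ l)) * i * two_mul_twist (l := l) j
    -- For $d$ odd, the coefficient of $i$ is $2(d+2\cdot\ast)$, twice a unit; the unit is absorbed
    -- by reindexing $i$.
    · refine ⟨2, fun j => ?_⟩
      have h1 : (2 * d).choose 2 = d * (2 * d - 1) := by
        rw [Nat.choose_two_right]
        apply Nat.div_eq_of_eq_mul_left two_pos
        ring
      obtain ⟨y, hy⟩ := twist_eq_two_mul (l := l) j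
      rw [← sum_isUnit_mul (isUnit_natCast_add_two_mul hd
        (((d * (2 * d - 1) : ℕ) : ZMod (2 ^ l)) * y))
        (fun i => LinearMap.trace ℂ V (ρ (R (2 * i) (((2 * d : ℕ) : ZMod k) * j))))]
      refine Finset.sum_congr rfl fun i _ => ?_
      rw [R_pow, h1]
      congr 3
      rw [Nat.cast_mul 2 d]
      simp only [Nat.cast_ofNat]
      linear_combination ((d * (2 * d - 1) : ℕ) : ZMod (2 ^ l)) * i * hy
  · rw [Finset.sum_comm]
    refine Finset.sum_nonneg fun j _ => ?_
    obtain ⟨d, rfl⟩ := hm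
    rw [← two_mul]
    -- For fixed $j$, an even power of `S i j` is a power of $a$ whose exponent is linear in $i$.
    have := MonoidHom.sum_trace_nonneg
      (ρ.comp (mulHom k ((half l + twist j) * (d : ZMod (2 ^ l)))))
    refine this.trans_eq (Fintype.sum_equiv Multiplicative.toAdd _ _ fun i => ?_)
    rw [S_pow_two_mul, mul_comm (Multiplicative.toAdd i)]
    rfl

open scoped ComplexOrder in
-- The map $x\mapsto x^m$ need not be a homomorphism, but it has the same trace sum as the
-- endomorphism `powHom hm`.
theorem sum_trace_pow_nonneg_of_odd [NeZero k] [Fintype (DihedralModel l k)]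
    (ρ : DihedralModel l k →* Module.End ℂ V) {m : ℕ} (hm : Odd m) :
    0 ≤ ∑ x, LinearMap.trace ℂ V (ρ (x ^ m)) := by
  suffices ∑ x, LinearMap.trace ℂ V (ρ (x ^ m)) =
      ∑ x, LinearMap.trace ℂ V (ρ (powHom hm x)) by
    rw [this]
    exact MonoidHom.sum_trace_nonneg (ρ.comp (powHom hm))
  rw [sum_eq, sum_eq]
  congr 1
  · rw [Finset.sum_comm, Finset.sum_comm (γ := ZMod (2 ^ l))]
    refine Finset.sum_congr rfl fun j _ => ?_
    obtain ⟨y, hy⟩ := twist_eq_two_mul (l := l) j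
    refine Eq.trans ?_ (sum_isUnit_mul (isUnit_natCast_add_two_mul hm
        ((m.choose 2 : ZMod (2 ^ l)) * (2 * y)))
        (fun i => LinearMap.trace ℂ V (ρ (R i ((m : ZMod k) * j)))))
    refine Finset.sum_congr rfl fun i _ => ?_
    rw [R_pow, hy]
    congr 3
    ring
  · rw [Finset.sum_comm, Finset.sum_comm (γ := ZMod (2 ^ l))]
    refine Finset.sum_congr rfl fun j _ => ?_
    obtain ⟨d, hd⟩ := hm
    obtain ⟨y, hy⟩ : ∃ y, half l + twist (l := l) j = 2 * y := by
      rcases twist_cases (l := l) j with h | h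
      · exact ⟨quarter l, by rw [h, half_eq, add_zero]⟩
      · exact ⟨half l, by rw [h, two_mul]⟩
    obtain ⟨z, hz⟩ := twist_eq_two_mul (l := l) ((d : ZMod k) * j)
    trans ∑ i, LinearMap.trace ℂ V (ρ (S i j))
    · refine Eq.trans ?_ (sum_isUnit_mul (isUnit_natCast_add_two_mul odd_one
        (y * (d : ZMod (2 ^ l)))) (fun i => LinearMap.trace ℂ V (ρ (S i j))))
      refine Finset.sum_congr rfl fun i _ => ?_
      rw [hd, pow_succ, S_pow_two_mul, R_mul_S, hy, map_zero]
      congr 3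
      · push_cast
        ring
      · ring
    · refine Eq.trans ?_ (sum_isUnit_mul (isUnit_natCast_add_two_mul odd_one (2 * z))
        (fun i => LinearMap.trace ℂ V (ρ (S i ((m : ZMod k) * j)))))
      refine Finset.sum_congr rfl fun i _ => ?_
      -- Conjugation by $u^{-dj}$ shifts the exponent $j$ of $u$ to $j+2dj=mj$ and multiplies $i$ by
      -- the unit $1+\mathrm{twist}(dj)$.
      have h : R 0 (-((d : ZMod k) * j)) * S i j =
          S ((((1 : ℕ) : ZMod (2 ^ l)) + 2 * (2 * z)) * i) ((m : ZMod k) * j) *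
            R 0 (-((d : ZMod k) * j)) := by
        rw [R_mul_S, S_mul_R, S_inj, twist_neg, hz, hd]
        push_cast
        constructor <;> ring
      rw [← eq_inv_mul_iff_mul_eq] at h
      rw [h, map_mul, LinearMap.trace_mul_comm, ← map_mul, mul_inv_cancel_right]

/-! ### An element with abelian centralizer -/

theorem S_one_zero_mul_self : (S 1 0 * S 1 0 : DihedralModel l k) = R (half l) 0 := by
  rw [S_mul_self, map_zero, add_zero, one_mul]

theorem R_half_ne_one : (R (half l) 0 : DihedralModel l k) ≠ 1 := fun h =>
  half_ne_zero (R_eq_one.1 h).1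

/-- This is the source of the indicator $-1$: all elements inverting $av$ share the nontrivial
square $(av)^2=a^h$. -/
theorem mul_self_of_inverts [NeZero k] {x : DihedralModel l k} (h : S 1 0 * x * S 1 0 = x) :
    x * x = R (half l) 0 := by
  rcases cases_R_S x with ⟨i, j, rfl⟩ | ⟨i, j, rfl⟩
  · rw [S_mul_R, S_mul_S, R_inj, map_add, map_zero] at h
    have hj : 2 * j = 0 := by linear_combination -h.2
    have hj' := twist_eq_zero_of_two_mul (l := l) hj
    have h1 := h.1
    rw [hj'] at h1
    have hi : 2 * i = half l := by
      rcases half_mul_cases i with hi | hi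
      · linear_combination -h1 + hi
      · have h2 : 2 * i = 0 := by linear_combination -h1 + hi + two_mul_half (l := l)
        exact absurd (hi.symm.trans (half_mul_eq_zero_of_two_mul h2)) half_ne_zero
    rw [R_mul_R, R_inj, hj']
    constructor
    · linear_combination hi
    · linear_combination hj
  · rw [S_mul_S, R_mul_S, S_inj] at h
    have hj : 2 * j = 0 := by linear_combination -h.2
    have hj' := twist_eq_zero_of_two_mul (l := l) hj
    have h1 := h.1
    simp only [hj', map_zero, map_sub] at h1
    rcases half_mul_cases i with hi | hi
    · obtain ⟨m, rfl⟩ := exists_eq_two_mul_of_half_mul hi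
      refine absurd ?_ (half_ne_zero (l := l))
      linear_combination (1 - 2 * m) * half_eq (l := l) + quarter l * h1 - quarter l * hi +
        m * two_mul_half (l := l)
    · rw [S_mul_self, hj', R_inj]
      exact ⟨by linear_combination hi, rfl⟩

/-- The conditions $2i'=0$, $2j'=0$, $\mathrm{twist}\,j'=0$ no longer involve the reflection, and
they make the rotation central. -/
theorem commute_of_commute_S_R [NeZero k] {i i' : ZMod (2 ^ l)} {j j' : ZMod k}
    (h : Commute (S i j) (R i' j')) (x : DihedralModel l k) : Commute (R i' j') x := by
  obtain ⟨h1, h2, h3⟩ := of_commute_S_R h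
  have h4 := half_mul_eq_zero_of_two_mul h1
  have h5 : ∀ j : ZMod k, i' * twist j = 0 := fun j => by
    rcases twist_cases (l := l) j with h | h <;> rw [h]
    · exact mul_zero _
    · rw [mul_comm, h4]
  rcases cases_R_S x with ⟨m, n, rfl⟩ | ⟨m, n, rfl⟩
  · rw [commute_iff_eq, R_mul_R, R_mul_R, R_inj, h3]
    constructor
    · linear_combination -h5 n
    · ring
  · rw [commute_iff_eq, R_mul_S, S_mul_R, S_inj, h3]
    constructor
    · linear_combination -h5 n + h1 - h4
    · linear_combination -h2

/-- Rotations centralizing the reflection $s$ are central, and a reflection $x$ centralizing $s$ is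
$s^{-1}$ times the central rotation $sx$. -/
theorem commute_of_commute_S [NeZero k] {i : ZMod (2 ^ l)} {j : ZMod k} {x y : DihedralModel l k}
    (hx : Commute (S i j) x) (hy : Commute (S i j) y) : Commute x y := by
  rcases cases_R_S x with ⟨m, n, rfl⟩ | ⟨m, n, rfl⟩
  · exact commute_of_commute_S_R hx _
  rcases cases_R_S y with ⟨m', n', rfl⟩ | ⟨m', n', rfl⟩
  · exact (commute_of_commute_S_R hy _).symm
  have h := ((Commute.refl (S i j)).mul_right hx)
  rw [S_mul_S] at h
  have h' := commute_of_commute_S_R h (S m' n')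
  rw [← S_mul_S] at h'
  have := (hy.inv_left).mul_left h'
  rwa [inv_mul_cancel_left] at this

end DihedralModel

/-! ### Monomial representations -/

section Monomial

variable {G : Type*} [Group G] {V : Type*} [AddCommGroup V] [Module ℂ V]

/-- The stabilizer of the line spanned by `w`. -/
def lineStabilizer (ρ : G →* Module.End ℂ V) (w : V) : Subgroup G where
  carrier := {g | ∃ a : ℂˣ, ρ g w = (a : ℂ) • w}
  one_mem' := ⟨1, by simp⟩
  mul_mem' := by
    rintro x y ⟨a, ha⟩ ⟨b, hb⟩
    refine ⟨a * b, ?_⟩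
    rw [map_mul, Module.End.mul_apply, hb, map_smul, ha, smul_smul, Units.val_mul, mul_comm]
  inv_mem' := by
    rintro x ⟨a, ha⟩
    refine ⟨a⁻¹, ?_⟩
    have h : ρ x⁻¹ (ρ x w) = w := by
      rw [← Module.End.mul_apply, ← map_mul, inv_mul_cancel, map_one, Module.End.one_apply]
    rw [ha, map_smul] at h
    conv_rhs => rw [← h, smul_smul, Units.inv_mul, one_smul]

/-- If `K` acts on `w` by scalars, and `t` preserves the corresponding weight, then there is a
common eigenvector of `K` and `t`. -/
theorem exists_lineStabilizer_extend [FiniteDimensional ℂ V] {ρ : G →* Module.End ℂ V}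
    {K : Subgroup G} {c : G → ℂ} {w : V} (hw : w ≠ 0)
    (hc : ∀ k ∈ K, ρ k w = c k • w) {t : G} (ht : ∀ k ∈ K, t⁻¹ * k * t ∈ K)
    (htc : ∀ k ∈ K, c (t⁻¹ * k * t) = c k) :
    ∃ w' : V, w' ≠ 0 ∧ K ≤ lineStabilizer ρ w' ∧ t ∈ lineStabilizer ρ w' := by
  let U : Submodule ℂ V :=
    { carrier := {v | ∀ k ∈ K, ρ k v = c k • v}
      add_mem' := fun hx hy k hk => by rw [map_add, hx k hk, hy k hk, smul_add]
      zero_mem' := fun k _ => by rw [map_zero, smul_zero]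
      smul_mem' := fun a x hx k hk => by rw [map_smul, hx k hk, smul_comm] }
  have hU : ∀ v ∈ U, ρ t v ∈ U := by
    intro v hv k hk
    rw [← Module.End.mul_apply, ← map_mul, show k * t = t * (t⁻¹ * k * t) by group, map_mul,
      Module.End.mul_apply, hv _ (ht k hk), map_smul, htc k hk]
  have : Nontrivial U := ⟨⟨⟨w, hc⟩, 0, fun h => hw (congrArg Subtype.val h)⟩⟩
  obtain ⟨μ, hμ⟩ := Module.End.exists_eigenvalue ((ρ t).restrict hU)
  obtain ⟨w', hw'⟩ := hμ.exists_hasEigenvector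
  have hne : (w' : V) ≠ 0 := fun h => hw'.2 (Subtype.ext h)
  have hinv : ∀ g, Function.Injective (ρ g) := fun g => Function.LeftInverse.injective
    (g := ρ g⁻¹) fun v => by
      rw [← Module.End.mul_apply, ← map_mul, inv_mul_cancel, map_one, Module.End.one_apply]
  have hunit : ∀ (g : G) (a : ℂ), ρ g (w' : V) = a • (w' : V) → g ∈ lineStabilizer ρ (w' : V) := by
    intro g a h
    have ha : a ≠ 0 := by
      rintro rfl
      rw [zero_smul, ← map_zero (ρ g)] at h
      exact hne (hinv g h)
    exact ⟨Units.mk0 a ha, h⟩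
  exact ⟨w', hne, fun k hk => hunit k _ (w'.2 k hk),
    hunit t μ (congrArg Subtype.val hw'.apply_eq_smul)⟩

/-- `w` is a weight vector of the normal subgroup `K`, with weight `c` extended by zero, such that
the stabilizer of the weight is `K` and the translates of `w` span the representation. -/
structure IsMonomialVector (ρ : G →* Module.End ℂ V) (K : Subgroup G) (c : G → ℂ) (w : V) :
    Prop where
  ne_zero : w ≠ 0
  conj_mem : ∀ k ∈ K, ∀ x, x * k * x⁻¹ ∈ K
  apply_mem : ∀ k ∈ K, ρ k w = c k • w
  apply_notMem : ∀ x, x ∉ K → c x = 0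
  mem_of_stab : ∀ x, (∀ k ∈ K, c (x * k * x⁻¹) = c k) → x ∈ K
  span_eq : Submodule.span ℂ (Set.range fun x => ρ x w) = ⊤

/-- Irreducible representations of a group with an abelian normal subgroup with abelian quotient
have monomial vectors. -/
theorem exists_isMonomialVector [Finite G] [FiniteDimensional ℂ V] [Nontrivial V]
    {ρ : G →* Module.End ℂ V}
    (hρ : ∀ v, v ≠ 0 → Submodule.span ℂ (Set.range fun x => ρ x v) = ⊤)
    {N : Subgroup G} (hN : ∀ x ∈ N, ∀ y ∈ N, x * y = y * x)
    (hcomm : ∀ x y : G, x * y * x⁻¹ * y⁻¹ ∈ N) :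
    ∃ (K : Subgroup G) (c : G → ℂ) (w : V), N ≤ K ∧ IsMonomialVector ρ K c w := by
  classical
  have hex : ∀ w : V, ∃ c : G → ℂ, (∀ k ∈ lineStabilizer ρ w, ρ k w = c k • w) ∧
      ∀ x, x ∉ lineStabilizer ρ w → c x = 0 := by
    intro w
    refine ⟨fun g => if h : ∃ a : ℂˣ, ρ g w = (a : ℂ) • w then (h.choose : ℂ) else 0,
      fun k hk => ?_, fun x hx => dif_neg hx⟩
    have hk' : ∃ a : ℂˣ, ρ k w = (a : ℂ) • w := hk
    simp only [dif_pos hk']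
    exact hk'.choose_spec
  obtain ⟨w₀, hw₀, hNw₀⟩ : ∃ w : V, w ≠ 0 ∧ N ≤ lineStabilizer ρ w := by
    obtain ⟨v, hv⟩ := exists_ne (0 : V)
    -- Take $w$ with $N\cap\mathrm{Stab}$ maximal. As $N$ is abelian, each $n\in N$ preserves the
    -- weight space, so an eigenvector of $n$ in it would enlarge the intersection unless $n$
    -- already belongs.
    obtain ⟨_, ⟨w, hw, rfl⟩, hmax⟩ := (Set.toFinite
      {K : Subgroup G | ∃ w : V, w ≠ 0 ∧ N ⊓ lineStabilizer ρ w = K}).exists_maximal ⟨_, v, hv, rfl⟩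
    refine ⟨w, hw, fun n hn => ?_⟩
    obtain ⟨c, hc, -⟩ := hex w
    have hconj : ∀ k ∈ N ⊓ lineStabilizer ρ w, n⁻¹ * k * n = k := fun k hk => by
      rw [mul_assoc, hN k hk.1 n hn, inv_mul_cancel_left]
    obtain ⟨w', hw', hK', hn'⟩ := exists_lineStabilizer_extend hw
      (K := N ⊓ lineStabilizer ρ w) (fun k hk => hc k hk.2) (t := n)
      (fun k hk => by rwa [hconj k hk]) (fun k hk => by rw [hconj k hk])
    exact (hmax ⟨w', hw', rfl⟩ (le_inf inf_le_left hK') ⟨hn, hn'⟩).2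
  -- Among vectors stabilized by $N$, maximize the full line stabilizer: it is normal because it
  -- contains all commutators, and any $x$ fixing its weight could be adjoined, hence lies in it.
  obtain ⟨_, ⟨w, hw, hNw, rfl⟩, hmax⟩ := (Set.toFinite
    {K : Subgroup G | ∃ w : V, w ≠ 0 ∧ N ≤ lineStabilizer ρ w ∧
      lineStabilizer ρ w = K}).exists_maximal ⟨_, w₀, hw₀, hNw₀, rfl⟩
  obtain ⟨c, hc, hc'⟩ := hex w
  have hconj : ∀ k ∈ lineStabilizer ρ w, ∀ x, x * k * x⁻¹ ∈ lineStabilizer ρ w := by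
    intro k hk x
    have := mul_mem (hNw (hcomm x k)) hk
    rwa [inv_mul_cancel_right] at this
  refine ⟨lineStabilizer ρ w, c, w, hNw, hw, hconj, hc, hc', fun x hx => ?_, hρ w hw⟩
  have hconj' : ∀ k ∈ lineStabilizer ρ w, x⁻¹ * k * x ∈ lineStabilizer ρ w := fun k hk => by
    simpa using hconj k hk x⁻¹
  obtain ⟨w', hw', hK', hx'⟩ := exists_lineStabilizer_extend hw hc (t := x) hconj'
    (fun k hk => by rw [← hx _ (hconj' k hk)]; group)
  exact hmax ⟨w', hw', hNw.trans hK', rfl⟩ hK' hx'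

theorem sum_eq_zero_of_mul_left [Fintype G] {f : G → ℂ} {a : ℂ} (ha : a ≠ 1) (k : G)
    (hf : ∀ y, f (k * y) = a * f y) : ∑ y, f y = 0 := by
  have h : ∑ y, f y = a * ∑ y, f y := by
    rw [Finset.mul_sum]
    refine (Equiv.sum_comp (Equiv.mulLeft k) f).symm.trans ?_
    exact Finset.sum_congr rfl fun y _ => hf y
  have h2 : (1 - a) * ∑ y, f y = 0 := by linear_combination h
  exact (mul_eq_zero.1 h2).resolve_left (sub_ne_zero.2 ha.symm)

namespace IsMonomialVector

variable {ρ : G →* Module.End ℂ V} {K : Subgroup G} {c : G → ℂ} {w : V}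

theorem map_mul_left (h : IsMonomialVector ρ K c w) {k : G} (hk : k ∈ K) (x : G) :
    c (k * x) = c k * c x := by
  by_cases hx : x ∈ K
  · apply smul_left_injective ℂ h.ne_zero
    show c (k * x) • w = (c k * c x) • w
    rw [← h.apply_mem _ (mul_mem hk hx), map_mul, Module.End.mul_apply, h.apply_mem x hx, map_smul,
      h.apply_mem k hk, smul_smul, mul_comm]
  · rw [h.apply_notMem x hx, mul_zero, h.apply_notMem]
    rwa [Subgroup.mul_mem_cancel_left _ hk]

theorem map_one (h : IsMonomialVector ρ K c w) : c 1 = 1 := by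
  apply smul_left_injective ℂ h.ne_zero
  show c 1 • w = (1 : ℂ) • w
  rw [← h.apply_mem 1 (one_mem _), _root_.map_one, Module.End.one_apply, one_smul]

theorem map_mul_right (h : IsMonomialVector ρ K c w) {k : G} (hk : k ∈ K) (x : G) :
    c (x * k) = c x * c k := by
  by_cases hx : x ∈ K
  · exact h.map_mul_left hx k
  · rw [h.apply_notMem x hx, zero_mul, h.apply_notMem]
    rwa [Subgroup.mul_mem_cancel_right _ hk]

theorem map_inv_mul (h : IsMonomialVector ρ K c w) {k : G} (hk : k ∈ K) : c k⁻¹ * c k = 1 := by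
  rw [← h.map_mul_left (inv_mem hk), inv_mul_cancel, h.map_one]

variable [Fintype G]

theorem natCard_ne_zero (K : Subgroup G) : (Nat.card K : ℂ) ≠ 0 :=
  Nat.cast_ne_zero.2 Nat.card_pos.ne'

open scoped Classical in
theorem sum_ite_mem (K : Subgroup G) : ∑ x : G, (if x ∈ K then (1 : ℂ) else 0) = Nat.card K := by
  rw [Finset.sum_boole, Nat.card_eq_fintype_card, Fintype.card_subtype]

theorem sum_smul_apply (h : IsMonomialVector ρ K c w) :
    ∑ y, c y⁻¹ • ρ y w = (Nat.card K : ℂ) • w := by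
  classical
  rw [← sum_ite_mem, Finset.sum_smul]
  refine Finset.sum_congr rfl fun y _ => ?_
  split_ifs with hy
  · rw [h.apply_mem y hy, smul_smul, h.map_inv_mul hy]
  · rw [h.apply_notMem _ (by rwa [inv_mem_iff]), zero_smul, zero_smul]

/-- The translate $\rho(x)w$ has a weight different from that of $w$, so the unnormalized projection
to the weight $c$ kills it, by orthogonality of characters of $K$. -/
theorem sum_smul_apply_eq_zero (h : IsMonomialVector ρ K c w) {x : G} (hx : x ∉ K) :
    ∑ y, c y⁻¹ • ρ y (ρ x w) = 0 := by
  have h1 : ∀ y, c y⁻¹ • ρ y (ρ x w) = (c y⁻¹ * c (x⁻¹ * y * x)) • ρ x w := by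
    intro y
    by_cases hy : y ∈ K
    · have hy' : x⁻¹ * y * x ∈ K := by simpa using h.conj_mem y hy x⁻¹
      rw [← Module.End.mul_apply, ← map_mul, show y * x = x * (x⁻¹ * y * x) by group, map_mul,
        Module.End.mul_apply, h.apply_mem _ hy', map_smul, smul_smul]
    · rw [h.apply_notMem _ (by rwa [inv_mem_iff]), zero_mul, zero_smul, zero_smul]
  simp only [h1, ← Finset.sum_smul]
  have hx' : x⁻¹ ∉ K := by rwa [inv_mem_iff]
  have h2 := mt (h.mem_of_stab x⁻¹) hx'
  push Not at h2
  obtain ⟨k, hk, hne⟩ := h2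
  rw [inv_inv] at hne
  rw [sum_eq_zero_of_mul_left (a := c k⁻¹ * c (x⁻¹ * k * x)) ?_ k, zero_smul]
  · intro y
    have hk' : x⁻¹ * k * x ∈ K := by simpa using h.conj_mem k hk x⁻¹
    rw [mul_inv_rev, h.map_mul_right (inv_mem hk),
      show x⁻¹ * (k * y) * x = (x⁻¹ * k * x) * (x⁻¹ * y * x) by group, h.map_mul_left hk']
    ring
  · intro h3
    apply hne
    have h4 := h.map_inv_mul hk
    have h5 : c k⁻¹ ≠ 0 := left_ne_zero_of_mul_eq_one h4
    exact mul_left_cancel₀ h5 (h3.trans h4.symm)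

/-- The coefficient functional of `w`. -/
theorem exists_coeff (h : IsMonomialVector ρ K c w) :
    ∃ f : Module.Dual ℂ V, ∀ x, f (ρ x w) = c x := by
  have hK := natCard_ne_zero K
  obtain ⟨f, hf⟩ := Module.Projective.exists_dual_eq_one ℂ h.ne_zero
  have hsum : ∀ x, (f ∘ₗ ∑ y, c y⁻¹ • ρ y) (ρ x w) = c x * Nat.card K := by
    intro x
    rw [LinearMap.comp_apply, LinearMap.sum_apply]
    simp only [LinearMap.smul_apply]
    by_cases hx : x ∈ K
    · simp only [h.apply_mem x hx, map_smul, smul_comm _ (c x), ← Finset.smul_sum,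
        h.sum_smul_apply]
      rw [hf, smul_eq_mul, smul_eq_mul, mul_one]
    · rw [h.sum_smul_apply_eq_zero hx, h.apply_notMem x hx, map_zero, zero_mul]
  refine ⟨(Nat.card K : ℂ)⁻¹ • (f ∘ₗ ∑ y, c y⁻¹ • ρ y), fun x => ?_⟩
  rw [LinearMap.smul_apply, hsum, smul_eq_mul]
  field_simp

/-- The character is induced from the weight. -/
theorem trace_eq [FiniteDimensional ℂ V] (h : IsMonomialVector ρ K c w) (g : G) :
    LinearMap.trace ℂ V (ρ g) = (Nat.card K : ℂ)⁻¹ * ∑ x, c (x⁻¹ * g * x) := by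
  obtain ⟨f, hf⟩ := h.exists_coeff
  have hK := natCard_ne_zero K
  -- The conjugates of the rank-one projection $v\mapsto f(v)w$ sum to $|K|$ times the identity;
  -- inserting this into the trace yields the induced character.
  have h1 : ∑ x, ρ x * f.smulRight w * ρ x⁻¹ = (Nat.card K : ℂ) • (1 : Module.End ℂ V) := by
    refine LinearMap.ext_on_range h.span_eq fun y => ?_
    rw [LinearMap.sum_apply, LinearMap.smul_apply, Module.End.one_apply, ← map_smul,
      ← h.sum_smul_apply, map_sum, ← Equiv.sum_comp (Equiv.mulLeft y)]
    refine Finset.sum_congr rfl fun x _ => ?_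
    rw [Module.End.mul_apply, Module.End.mul_apply, LinearMap.smulRight_apply,
      ← Module.End.mul_apply, ← map_mul, hf, map_smul, map_smul, ← Module.End.mul_apply, ← map_mul]
    simp
  rw [eq_inv_mul_iff_mul_eq₀ hK, ← smul_eq_mul, ← map_smul,
    ← mul_one (ρ g), ← mul_smul_comm, ← h1, Finset.mul_sum, map_sum]
  refine Finset.sum_congr rfl fun x _ => ?_
  rw [← mul_assoc, ← mul_assoc, LinearMap.trace_mul_comm, ← mul_assoc, ← mul_assoc, ← map_mul,
    ← map_mul]
  have : ρ (x⁻¹ * g * x) * f.smulRight w = f.smulRight (ρ (x⁻¹ * g * x) w) := by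
    ext v
    simp
  rw [this, LinearMap.trace_smulRight, hf]

variable {t : G}

/-- Replace $x$ by $tx$ and average over $xK$. For $x\in K$ each term is $c(tzt^{-1})c(z)=1$. For
$x\notin K$ the inner sum involves the character $y\mapsto c(txy(tx)^{-1})c(y)$ of $K$, which is
nontrivial because $t$ inverts $c$ and $x$ does not fix it. -/
theorem sum_sq (h : IsMonomialVector ρ K c w) (ht : t * t = 1)
    (htc : ∀ k ∈ K, c (t * k * t⁻¹) * c k = 1) : ∑ x, c (x * x) = Nat.card K := by
  classical
  have hK := natCard_ne_zero K
  have htinv : t⁻¹ = t := inv_eq_of_mul_eq_one_left ht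
  rw [← Equiv.sum_comp (Equiv.mulLeft t)]
  apply mul_left_cancel₀ hK
  have h1 : (Nat.card K : ℂ) * ∑ x, c (t * x * (t * x)) =
      ∑ x, ∑ y, (if y ∈ K then 1 else 0) * c (t * (x * y) * (t * (x * y))) := by
    rw [Finset.sum_comm, ← sum_ite_mem, Finset.sum_mul]
    refine Finset.sum_congr rfl fun y _ => ?_
    rw [← Finset.mul_sum]
    congr 1
    exact (Equiv.sum_comp (Equiv.mulRight y) fun x => c (t * x * (t * x))).symm
  have h2 : ∀ x, ∑ y, (if y ∈ K then 1 else 0) * c (t * (x * y) * (t * (x * y))) =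
      (if x ∈ K then 1 else 0) * (Nat.card K : ℂ) := by
    intro x
    split_ifs with hx
    · rw [one_mul, ← sum_ite_mem]
      refine Finset.sum_congr rfl fun y _ => ?_
      split_ifs with hy
      · have hxy := mul_mem hx hy
        rw [one_mul, ← htc _ hxy, htinv, ← h.map_mul_right hxy]
        simp only [mul_assoc]
      · rw [zero_mul]
    · rw [zero_mul]
      have h3 := mt (h.mem_of_stab x) hx
      push Not at h3
      obtain ⟨k, hk, hne⟩ := h3
      have h4 : ∀ y, (if y ∈ K then 1 else 0) * c (t * (x * y) * (t * (x * y))) =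
          (if y ∈ K then 1 else 0) * (c ((t * x) * y * (t * x)⁻¹) * c (t * x * (t * x)) * c y) := by
        intro y
        split_ifs with hy
        · rw [← h.map_mul_left (h.conj_mem y hy _), ← h.map_mul_right hy]
          congr 2
          group
        · rw [zero_mul, zero_mul]
      simp only [h4]
      refine sum_eq_zero_of_mul_left (a := c ((t * x) * k * (t * x)⁻¹) * c k) ?_ k fun y => ?_
      · intro h5
        apply hne
        have h6 := htc _ (h.conj_mem k hk x)
        rw [show t * (x * k * x⁻¹) * t⁻¹ = (t * x) * k * (t * x)⁻¹ by group] at h6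
        exact mul_left_cancel₀ (left_ne_zero_of_mul_eq_one h5) (h6.trans h5.symm)
      · rw [Subgroup.mul_mem_cancel_left _ hk, h.map_mul_left hk,
          show t * x * (k * y) * (t * x)⁻¹ = (t * x * k * (t * x)⁻¹) * (t * x * y * (t * x)⁻¹) by
            group, h.map_mul_left (h.conj_mem k hk _)]
        ring
  simp only [Equiv.coe_mulLeft]
  rw [h1]
  simp only [h2, ← Finset.sum_mul, sum_ite_mem]

/-- The second indicator is one if an involution (or the identity) inverts the weight. -/
theorem sum_trace_sq [FiniteDimensional ℂ V] (h : IsMonomialVector ρ K c w) (ht : t * t = 1)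
    (htc : ∀ k ∈ K, c (t * k * t⁻¹) * c k = 1) :
    ∑ g, LinearMap.trace ℂ V (ρ (g ^ 2)) = Fintype.card G := by
  have hK := natCard_ne_zero K
  simp only [h.trace_eq, ← Finset.mul_sum]
  rw [Finset.sum_comm]
  have : ∀ x, ∑ g, c (x⁻¹ * g ^ 2 * x) = Nat.card K := by
    intro x
    rw [← h.sum_sq ht htc]
    refine Eq.trans ?_ (Equiv.sum_comp (MulAut.conj x⁻¹).toEquiv fun x => c (x * x))
    refine Finset.sum_congr rfl fun g _ => ?_
    simp [pow_two, mul_assoc]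
  simp only [this, Finset.sum_const, Finset.card_univ, nsmul_eq_mul]
  field_simp

/-- A nondegenerate symmetric invariant form exists if an involution (or the identity) inverts the
weight. -/
theorem exists_symm_form [FiniteDimensional ℂ V] (h : IsMonomialVector ρ K c w)
    (hρ : ∀ v, v ≠ 0 → Submodule.span ℂ (Set.range fun x => ρ x v) = ⊤) (ht : t * t = 1)
    (htc : ∀ k ∈ K, c (t * k * t⁻¹) * c k = 1) :
    ∃ B : LinearMap.BilinForm ℂ V, B.Nondegenerate ∧ B.IsSymm ∧
      ∀ (g : G) (v v' : V), B (ρ g v) (ρ g v') = B v v' := by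
  classical
  obtain ⟨f, hf⟩ := h.exists_coeff
  have hK := natCard_ne_zero K
  -- Averaging makes $B(v,v')=\sum_g f(gv)f(tgv')$ invariant; $t^2=1$ makes it symmetric;
  -- $B(w,tw)=|K|$ because $t$ inverts $c$.
  let B : LinearMap.BilinForm ℂ V :=
    ∑ g, LinearMap.BilinForm.linMulLin (f ∘ₗ ρ g) (f ∘ₗ ρ (t * g))
  have hB : ∀ v v', B v v' = ∑ g, f (ρ g v) * f (ρ (t * g) v') := by
    intro v v'
    simp [B, LinearMap.sum_apply]
  have hinv : ∀ (g : G) (v v' : V), B (ρ g v) (ρ g v') = B v v' := by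
    intro g v v'
    rw [hB, hB]
    refine Eq.trans ?_ (Equiv.sum_comp (Equiv.mulRight g) fun x => f (ρ x v) * f (ρ (t * x) v'))
    simp
  have hsymm : ∀ v v', B v v' = B v' v := by
    intro v v'
    rw [hB, hB]
    refine Eq.trans ?_ (Equiv.sum_comp (Equiv.mulLeft t) fun x => f (ρ x v') * f (ρ (t * x) v))
    refine Finset.sum_congr rfl fun g _ => ?_
    rw [Equiv.coe_mulLeft, ← mul_assoc, ht, one_mul, mul_comm]
  have hne : B w (ρ t w) ≠ 0 := by
    convert hK
    rw [hB, ← sum_ite_mem]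
    refine Finset.sum_congr rfl fun g _ => ?_
    have htinv : t⁻¹ = t := inv_eq_of_mul_eq_one_left ht
    rw [← Module.End.mul_apply (ρ _), ← map_mul ρ, hf, hf]
    split_ifs with hg
    · rw [← htc g hg, htinv, mul_comm]
    · rw [h.apply_notMem g hg, zero_mul]
  have hleft : ∀ v, (∀ v', B v v' = 0) → v = 0 := by
    intro v hv
    by_contra hv0
    -- The translates of a nonzero vector in the radical would span $V$ by irreducibility.
    have h1 : B.flip (ρ t w) = 0 := by
      refine LinearMap.ext_on_range (hρ v hv0) fun x => ?_
      rw [LinearMap.BilinForm.flip_apply, LinearMap.zero_apply, ← hinv x⁻¹, ← Module.End.mul_apply,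
        ← map_mul, inv_mul_cancel, _root_.map_one, Module.End.one_apply, hv]
    exact hne (by simpa using LinearMap.congr_fun h1 w)
  exact ⟨B, ⟨hleft, fun v hv => hleft v fun v' => (hsymm v v').trans (hv v')⟩, ⟨hsymm⟩, hinv⟩

end IsMonomialVector

end Monomial

/-! ### Modules over group algebras -/

section GroupAlgebra

theorem sweedlerPower_zero (H : Type*) [Ring H] [HopfAlgebra ℂ H] (x : H) :
    sweedlerPower H 0 x = algebraMap ℂ H (Coalgebra.counit x) := by
  rw [sweedlerPower, pow_zero]
  rfl

theorem sweedlerPower_succ (H : Type*) [Ring H] [HopfAlgebra ℂ H] (m : ℕ) (x : H) :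
    sweedlerPower H (m + 1) x = LinearMap.mul' ℂ H
      (TensorProduct.map (sweedlerPower H m) LinearMap.id (Coalgebra.comul x)) := by
  rw [sweedlerPower, pow_succ]
  rfl

theorem sweedlerPower_of {G : Type*} [Group G] (m : ℕ) (g : G) :
    sweedlerPower (MonoidAlgebra ℂ G) m (MonoidAlgebra.of ℂ G g) =
      MonoidAlgebra.of ℂ G (g ^ m) := by
  induction m with
  | zero =>
    rw [sweedlerPower_zero]
    simp
  | succ m ih =>
    rw [sweedlerPower_succ]
    have : Coalgebra.comul (R := ℂ) (MonoidAlgebra.of ℂ G g) =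
        MonoidAlgebra.of ℂ G g ⊗ₜ[ℂ] MonoidAlgebra.of ℂ G g := by
      simp
    rw [this, TensorProduct.map_tmul, ih, LinearMap.mul'_apply, LinearMap.id_apply, ← map_mul,
      pow_succ]

variable {G : Type*} [Group G] {V : Type*} [AddCommGroup V] [Module ℂ V]
  [Module (MonoidAlgebra ℂ G) V] [IsScalarTower ℂ (MonoidAlgebra ℂ G) V]

variable (G V) in
/-- The action of the group on a module over the group algebra. -/
def moduleRep : G →* Module.End ℂ V :=
  ((Algebra.lsmul ℂ ℂ V : MonoidAlgebra ℂ G →ₐ[ℂ] Module.End ℂ V) : _ →* _).comp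
    (MonoidAlgebra.of ℂ G)

theorem moduleCharacter_of (g : G) :
    moduleCharacter (MonoidAlgebra ℂ G) V (MonoidAlgebra.of ℂ G g) =
      LinearMap.trace ℂ V (moduleRep G V g) := rfl

theorem indicator_eq_sum [Fintype G] (m : ℕ) :
    indicator (MonoidAlgebra ℂ G) V m =
      (Fintype.card G : ℂ)⁻¹ * ∑ g, LinearMap.trace ℂ V (moduleRep G V (g ^ m)) := by
  rw [indicator, MonoidAlgebra.isNormalizedIntegral.normalizedIntegral_eq, map_smul, map_smul,
    smul_eq_mul, map_sum, map_sum]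
  simp only [sweedlerPower_of, moduleCharacter_of]

theorem span_moduleRep_eq_top [IsSimpleModule (MonoidAlgebra ℂ G) V] (v : V) (hv : v ≠ 0) :
    Submodule.span ℂ (Set.range fun x => moduleRep G V x v) = ⊤ := by
  refine eq_top_iff.2 fun u hu => ?_
  clear hu
  obtain ⟨a, rfl⟩ := IsSimpleModule.toSpanSingleton_surjective (MonoidAlgebra ℂ G) hv u
  rw [LinearMap.toSpanSingleton_apply]
  induction a using MonoidAlgebra.induction_on with
  | of g => exact Submodule.subset_span ⟨g, rfl⟩
  | add a b ha hb => rw [add_smul]; exact add_mem ha hb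
  | smul r a ha => rw [smul_assoc]; exact Submodule.smul_mem _ _ ha

end GroupAlgebra

/-! ### Groups with an abelian normal subgroup and abelian quotient -/

section MetabelianGroup

theorem IsMonomialVector.apply_commutator {G : Type*} [Group G] {V : Type*} [AddCommGroup V] [Module ℂ V]
    {ρ : G →* Module.End ℂ V} {K : Subgroup G} {c : G → ℂ} {w : V}
    (h : IsMonomialVector ρ K c w) {x : G} (hx : x ∈ ⁅K, K⁆) : c x = 1 := by
  let L : Subgroup G :=
    { carrier := {x | x ∈ K ∧ c x = 1}
      one_mem' := ⟨one_mem _, h.map_one⟩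
      mul_mem' := fun ha hb => ⟨mul_mem ha.1 hb.1, by
        rw [h.map_mul_left ha.1, ha.2, hb.2, one_mul]⟩
      inv_mem' := fun {a} ha => ⟨inv_mem ha.1, by
        have := h.map_inv_mul ha.1
        rwa [ha.2, mul_one] at this⟩ }
  have hL : ⁅K, K⁆ ≤ L := by
    refine Subgroup.commutator_le.2 fun a ha b hb => ?_
    have ha' := inv_mem ha
    have hb' := inv_mem hb
    rw [commutatorElement_def]
    refine ⟨mul_mem (mul_mem (mul_mem ha hb) ha') hb', ?_⟩
    rw [h.map_mul_right hb', h.map_mul_right ha', h.map_mul_right hb]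
    linear_combination (c b⁻¹ * c b) * h.map_inv_mul ha + h.map_inv_mul hb
  exact (hL hx).2

variable {G : Type} [Group G] [Finite G] {N : Subgroup G}

/-- A finite group with an abelian normal subgroup with abelian quotient is an `M`-group. -/
theorem isMGroup_of_commutator_mem (hN : ∀ x ∈ N, ∀ y ∈ N, x * y = y * x)
    (hcomm : ∀ x y : G, x * y * x⁻¹ * y⁻¹ ∈ N) : IsMGroup G := by
  classical
  have := Fintype.ofFinite G
  intro V _ _ _ _ _ hV
  have : Nontrivial V := hV.nontrivial
  obtain ⟨K, c, w, -, h⟩ := exists_isMonomialVector (ρ := moduleRep G V)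
    span_moduleRep_eq_top hN hcomm
  let φ : K →* ℂˣ := MonoidHom.toHomUnits
    { toFun := fun k => c k
      map_one' := h.map_one
      map_mul' := fun k k' => h.map_mul_left k.2 k' }
  refine ⟨K, φ, fun g => ?_⟩
  rw [moduleCharacter_of, h.trace_eq, inducedCharacter, finsum_eq_sum_of_fintype]
  congr 1
  refine Finset.sum_congr rfl fun x _ => ?_
  split_ifs with hx
  · rfl
  · exact h.apply_notMem _ hx

theorem isMGroup_subgroup_of_commutator_mem (hN : ∀ x ∈ N, ∀ y ∈ N, x * y = y * x)
    (hcomm : ∀ x y : G, x * y * x⁻¹ * y⁻¹ ∈ N) (Q : Subgroup G) : IsMGroup Q :=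
  isMGroup_of_commutator_mem (N := N.subgroupOf Q)
    (fun _ hx _ hy => Subtype.ext (hN _ hx _ hy)) (fun _ _ => hcomm _ _)

variable (hN : ∀ x ∈ N, ∀ y ∈ N, x * y = y * x) (hcomm : ∀ x y : G, x * y * x⁻¹ * y⁻¹ ∈ N)
  (hinv : ∀ K : Subgroup G, N ≤ K → ∃ t : G, t * t = 1 ∧ ∀ x ∈ K, t * x * t⁻¹ * x ∈ ⁅K, K⁆)
include hN hcomm hinv

/-- The weight is a linear character of $K$, hence trivial on $[K,K]$, so inversion modulo $[K,K]$
inverts the weight. -/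
theorem exists_isMonomialVector_inverting {V : Type*} [AddCommGroup V] [Module ℂ V]
    [FiniteDimensional ℂ V] [Nontrivial V] {ρ : G →* Module.End ℂ V}
    (hρ : ∀ v, v ≠ 0 → Submodule.span ℂ (Set.range fun x => ρ x v) = ⊤) :
    ∃ (K : Subgroup G) (c : G → ℂ) (w : V) (t : G), IsMonomialVector ρ K c w ∧ t * t = 1 ∧
      ∀ k ∈ K, c (t * k * t⁻¹) * c k = 1 := by
  obtain ⟨K, c, w, hNK, h⟩ := exists_isMonomialVector hρ hN hcomm
  obtain ⟨t, ht, htK⟩ := hinv K hNK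
  refine ⟨K, c, w, t, h, ht, fun k hk => ?_⟩
  rw [← h.map_mul_right hk, h.apply_commutator (htK k hk)]

theorem isTotallyOrthogonal_of_inverting : IsTotallyOrthogonal G := by
  have := Fintype.ofFinite G
  intro V _ _ _ _ _ hV
  have : Nontrivial V := hV.nontrivial
  obtain ⟨K, c, w, t, h, ht, htc⟩ :=
    exists_isMonomialVector_inverting hN hcomm hinv (span_moduleRep_eq_top (G := G) (V := V))
  exact h.exists_symm_form span_moduleRep_eq_top ht htc

theorem indicator_two_eq_one_of_inverting {V : Type*} [AddCommGroup V] [Module ℂ V]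
    [FiniteDimensional ℂ V] [Module (MonoidAlgebra ℂ G) V] [IsScalarTower ℂ (MonoidAlgebra ℂ G) V]
    [hV : IsSimpleModule (MonoidAlgebra ℂ G) V] : indicator (MonoidAlgebra ℂ G) V 2 = 1 := by
  have := Fintype.ofFinite G
  have : Nontrivial V := hV.nontrivial
  obtain ⟨K, c, w, t, h, ht, htc⟩ :=
    exists_isMonomialVector_inverting hN hcomm hinv (span_moduleRep_eq_top (G := G) (V := V))
  rw [indicator_eq_sum, h.sum_trace_sq ht htc, inv_mul_cancel₀]
  simp

end MetabelianGroup

/-! ### Symmetric separability elements -/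

/-- The algebra homomorphism given by a module. -/
def actionHom (A : Type*) [Ring A] [Algebra ℂ A] (V : Type*) [AddCommGroup V] [Module ℂ V]
    [Module A V] [IsScalarTower ℂ A V] : A →ₐ[ℂ] Module.End ℂ V :=
  Algebra.lsmul ℂ ℂ V

theorem actionHom_apply {A : Type*} [Ring A] [Algebra ℂ A] {V : Type*} [AddCommGroup V]
    [Module ℂ V] [Module A V] [IsScalarTower ℂ A V] (a : A) (v : V) :
    actionHom A V a v = a • v := rfl

/-- The element `∑ x i ⊗ y i` is a symmetric separability element of `A`. -/
structure IsSymmSeparability {A : Type*} [Ring A] [Algebra ℂ A] {ι : Type*} [Fintype ι]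
    (x y : ι → A) : Prop where
  sum_mul : ∑ i, x i * y i = 1
  outer : ∀ a, ∑ i, (a * x i) ⊗ₜ[ℂ] y i = ∑ i, x i ⊗ₜ[ℂ] (y i * a)
  inner : ∀ a, ∑ i, (x i * a) ⊗ₜ[ℂ] y i = ∑ i, x i ⊗ₜ[ℂ] (a * y i)

namespace IsSymmSeparability

variable {A : Type*} [Ring A] [Algebra ℂ A] {ι : Type*} [Fintype ι] {x y : ι → A}

theorem apply_outer (h : IsSymmSeparability x y) {M : Type*} [AddCommGroup M] [Module ℂ M]
    (F : A →ₗ[ℂ] A →ₗ[ℂ] M) (a : A) : ∑ i, F (a * x i) (y i) = ∑ i, F (x i) (y i * a) := by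
  simpa using congrArg (TensorProduct.lift F) (h.outer a)

theorem apply_inner (h : IsSymmSeparability x y) {M : Type*} [AddCommGroup M] [Module ℂ M]
    (F : A →ₗ[ℂ] A →ₗ[ℂ] M) (a : A) : ∑ i, F (x i * a) (y i) = ∑ i, F (x i) (a * y i) := by
  simpa using congrArg (TensorProduct.lift F) (h.inner a)

variable {V : Type*} [AddCommGroup V] [Module ℂ V] [Module A V] [IsScalarTower ℂ A V]

/-- Modules over an algebra with a separability element are semisimple. -/
theorem isSemisimpleModule (h : IsSymmSeparability x y) : IsSemisimpleModule A V := by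
  refine { exists_isCompl := fun U => ?_ }
  obtain ⟨π, hπ⟩ := (U.restrictScalars ℂ).subtype.exists_leftInverse_of_injective
    (Submodule.ker_subtype _)
  -- Maschke averaging: $\sum x_i\pi' y_i$ is $A$-linear by `outer` and is the identity on $U$ by
  -- `sum_mul`.
  let π' : Module.End ℂ V := (U.restrictScalars ℂ).subtype ∘ₗ π
  let F : A →ₗ[ℂ] A →ₗ[ℂ] Module.End ℂ V :=
    LinearMap.compl₁₂ (LinearMap.mul ℂ (Module.End ℂ V))
      (LinearMap.mulRight ℂ π' ∘ₗ (actionHom A V).toLinearMap) (actionHom A V).toLinearMap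
  have hF : ∀ a b v, F a b v = a • π' (b • v) := fun a b v => rfl
  have hmem : ∀ v, (∑ i, F (x i) (y i)) v ∈ U := by
    intro v
    rw [LinearMap.sum_apply]
    exact Submodule.sum_mem _ fun i _ => U.smul_mem _ (π (y i • v)).2
  let p : V →ₗ[A] U :=
    { toFun := fun v => ⟨(∑ i, F (x i) (y i)) v, hmem v⟩
      map_add' := fun v w => Subtype.ext (map_add _ v w)
      map_smul' := fun a v => by
        refine Subtype.ext ?_
        have h1 := LinearMap.congr_fun (h.apply_outer F a) v
        simp only [LinearMap.sum_apply, hF, mul_smul] at h1 ⊢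
        rw [← h1, RingHom.id_apply, Submodule.coe_smul, Finset.smul_sum] }
  refine ⟨LinearMap.ker p, LinearMap.isCompl_of_proj fun u => Subtype.ext ?_⟩
  show (∑ i, F (x i) (y i)) u = u
  rw [LinearMap.sum_apply]
  have h2 : ∀ u' ∈ U, π' u' = u' := fun u' hu' =>
    congrArg Subtype.val (LinearMap.congr_fun hπ ⟨u', hu'⟩)
  simp only [hF, h2 _ (U.smul_mem _ u.2), smul_smul]
  rw [← Finset.sum_smul, h.sum_mul, one_smul]

variable [FiniteDimensional ℂ V]

/-- The sum is the trace of the idempotent through which $\sum x_i\otimes y_i$ acts on $V\otimes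
V^*$. In characteristic zero a vanishing trace would make the idempotent zero, and contraction would
give $v=\sum x_iy_iv=0$ for all $v$. -/
theorem sum_trace_mul_trace_ne_zero [Nontrivial V] (h : IsSymmSeparability x y) :
    ∑ i, LinearMap.trace ℂ V (actionHom A V (x i)) * LinearMap.trace ℂ V (actionHom A V (y i)) ≠
      0 := by
  let T : A →ₗ[ℂ] A →ₗ[ℂ] Module.End ℂ (V ⊗[ℂ] Module.Dual ℂ V) :=
    LinearMap.compl₁₂ (TensorProduct.mapBilinear (.id ℂ) V (Module.Dual ℂ V) V (Module.Dual ℂ V))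
      (actionHom A V).toLinearMap (Module.Dual.transpose ∘ₗ (actionHom A V).toLinearMap)
  have hT : ∀ a b, T a b = TensorProduct.map (actionHom A V a)
    (Module.Dual.transpose (R := ℂ) (actionHom A V b)) := fun a b => rfl
  have hTT : ∀ a b a' b', T a b * T a' b' = T (a * a') (b' * b) := by
    intro a b a' b'
    rw [hT, hT, hT, map_mul, map_mul]
    ext
    rfl
  have htr : ∀ a b, LinearMap.trace ℂ _ (T a b) =
      LinearMap.trace ℂ V (actionHom A V a) * LinearMap.trace ℂ V (actionHom A V b) := by
    intro a b
    rw [hT, LinearMap.trace_tensorProduct', LinearMap.trace_transpose']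
  have hidem : IsIdempotentElem (∑ i, T (x i) (y i)) := by
    rw [IsIdempotentElem, Finset.sum_mul]
    simp only [Finset.mul_sum, hTT]
    have h1 : ∀ i, ∑ j, T (x i * x j) (y j * y i) = ∑ j, T (x j) (y j * (x i * y i)) := by
      intro i
      have := h.apply_outer (T.compl₂ (LinearMap.mulRight ℂ (y i))) (x i)
      simpa [mul_assoc] using this
    simp only [h1]
    rw [Finset.sum_comm]
    simp only [← map_sum, ← Finset.mul_sum, h.sum_mul, mul_one]
  intro h0
  simp only [← htr, ← map_sum] at h0
  have h1 := LinearMap.IsIdempotentElem.eq_zero_of_trace_eq_zero hidem h0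
  obtain ⟨v, hv⟩ := exists_ne (0 : V)
  apply hv
  let b := Module.finBasis ℂ V
  have h2 : ∀ k, ∑ i, b.coord k (y i • v) • x i • b k = 0 := by
    intro k
    have := congrArg (fun z => dualTensorHom ℂ V V (TensorProduct.comm ℂ _ _ z) v)
      (LinearMap.congr_fun h1 (b k ⊗ₜ b.coord k))
    simpa [hT, LinearMap.sum_apply, actionHom_apply, Module.Dual.transpose_apply] using this
  have h3 : ∑ k, ∑ i, b.coord k (y i • v) • x i • b k = 0 :=
    Finset.sum_eq_zero fun k _ => h2 k
  rw [Finset.sum_comm] at h3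
  have h4 : ∀ i, ∑ k, b.coord k (y i • v) • x i • b k = (x i * y i) • v := by
    intro i
    rw [mul_smul]
    conv_rhs => rw [← b.sum_repr (y i • v), Finset.smul_sum]
    refine Finset.sum_congr rfl fun k _ => ?_
    rw [smul_comm]
    rfl
  simp only [h4] at h3
  rw [← Finset.sum_smul, h.sum_mul, one_smul] at h3
  exact h3

end IsSymmSeparability

/-- A nonzero module over an algebra with an anti-homomorphism `S` preserving characters carries a
nonzero invariant form. -/
theorem IsSymmSeparability.exists_form {A : Type*} [Ring A] [Algebra ℂ A] {ι : Type*} [Fintype ι]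
    {x y : ι → A} (h : IsSymmSeparability x y) {S : A →ₗ[ℂ] A} (hS : ∀ a b, S (a * b) = S b * S a)
    {V : Type*} [AddCommGroup V] [Module ℂ V] [Module A V] [IsScalarTower ℂ A V]
    [FiniteDimensional ℂ V] [Nontrivial V]
    (hχ : ∀ a, LinearMap.trace ℂ V (actionHom A V (S a)) = LinearMap.trace ℂ V (actionHom A V a)) :
    ∃ B : V →ₗ[ℂ] Module.Dual ℂ V, B ≠ 0 ∧ ∀ a v w, B (a • v) w = B v (S a • w) := by
  let F : Module.Dual ℂ V → Module.Dual ℂ V → V → V → A →ₗ[ℂ] A →ₗ[ℂ] ℂ := fun f f' v w =>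
    LinearMap.compl₁₂ (LinearMap.mul ℂ ℂ)
      (f ∘ₗ (LinearMap.toSpanSingleton A V v).restrictScalars ℂ)
      (f' ∘ₗ (LinearMap.toSpanSingleton A V w).restrictScalars ℂ ∘ₗ S)
  have hF : ∀ f f' v w a b, F f f' v w a b = f (a • v) * f' (S b • w) := fun _ _ _ _ _ _ => rfl
  by_contra hB
  push Not at hB
  -- By `inner`, each such sum is an invariant form in $(v,w)$, so under the contrary assumption it
  -- vanishes. Summing over dual bases then gives $\sum\chi(x_i)\chi(Sy_i)=0$, impossible when
  -- $\chi\circ S=\chi$.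
  have hzero : ∀ (f f' : Module.Dual ℂ V) (v w : V), ∑ i, f (x i • v) * f' (S (y i) • w) = 0 := by
    intro f f' v w
    let B : V →ₗ[ℂ] Module.Dual ℂ V := ∑ i, LinearMap.compl₁₂ (LinearMap.mul ℂ ℂ)
      (f ∘ₗ actionHom A V (x i))
      (f' ∘ₗ actionHom A V (S (y i)))
    have hBapp : ∀ v w, B v w = ∑ i, f (x i • v) * f' (S (y i) • w) := by
      intro v w
      simp [B, LinearMap.sum_apply, actionHom_apply]
    by_contra hne
    obtain ⟨a, v', w', h1⟩ := hB B (by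
      rintro h0
      rw [← hBapp, h0] at hne
      exact hne rfl)
    apply h1
    have := h.apply_inner (F f f' v' w') a
    simp only [hF, hS, mul_smul] at this
    rw [hBapp, hBapp, this]
  apply h.sum_trace_mul_trace_ne_zero (V := V)
  let b := Module.finBasis ℂ V
  have htr : ∀ a, LinearMap.trace ℂ V (actionHom A V a) = ∑ k, b.coord k (a • b k) := by
    intro a
    rw [LinearMap.trace_eq_matrix_trace ℂ b, Matrix.trace]
    simp [LinearMap.toMatrix_apply, actionHom_apply]
  have h1 : ∀ i, LinearMap.trace ℂ V (actionHom A V (x i)) *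
      LinearMap.trace ℂ V (actionHom A V (y i)) =
      ∑ k, ∑ k', b.coord k (x i • b k) * b.coord k' (S (y i) • b k') := by
    intro i
    rw [← Finset.sum_mul_sum, ← htr, ← htr, hχ]
  simp only [h1]
  rw [Finset.sum_comm]
  refine Finset.sum_eq_zero fun k _ => ?_
  rw [Finset.sum_comm]
  exact Finset.sum_eq_zero fun k' _ => hzero _ _ _ _

/-- If `S` is an anti-homomorphism preserving all characters, then all modules are self-dual. -/
theorem IsSymmSeparability.exists_equiv_dual {A : Type*} [Ring A] [Algebra ℂ A] {ι : Type*}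
    [Fintype ι] {x y : ι → A} (h : IsSymmSeparability x y) {S : A →ₗ[ℂ] A}
    (hS : ∀ a b, S (a * b) = S b * S a)
    (hχ : ∀ (V : Type) [AddCommGroup V] [Module ℂ V] [FiniteDimensional ℂ V] [Module A V]
      [IsScalarTower ℂ A V] (a : A),
        LinearMap.trace ℂ V (actionHom A V (S a)) = LinearMap.trace ℂ V (actionHom A V a))
    (n : ℕ) (V : Type) [AddCommGroup V] [Module ℂ V] [FiniteDimensional ℂ V] [Module A V]
    [IsScalarTower ℂ A V] (hn : Module.finrank ℂ V = n) :
    ∃ e : V ≃ₗ[ℂ] Module.Dual ℂ V, ∀ (a : A) (v w : V), e (a • v) w = e v (S a • w) := by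
  suffices ∃ B : V →ₗ[ℂ] Module.Dual ℂ V, Function.Injective B ∧
      ∀ (a : A) (v w : V), B (a • v) w = B v (S a • w) by
    obtain ⟨B, hB, hinv⟩ := this
    exact ⟨LinearEquiv.ofInjectiveOfFinrankEq B hB Subspace.dual_finrank_eq.symm, hinv⟩
  induction n using Nat.strong_induction_on generalizing V with
  | _ n ih =>
    subst hn
    rcases subsingleton_or_nontrivial V with hV | hV
    · exact ⟨0, Function.injective_of_subsingleton _, fun _ _ _ => rfl⟩
    have hfin : ∀ U : Submodule A V, FiniteDimensional ℂ U := fun U =>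
      inferInstanceAs (FiniteDimensional ℂ (U.restrictScalars ℂ))
    have hlt : ∀ U : Submodule A V, U ≠ ⊤ → Module.finrank ℂ U < Module.finrank ℂ V := by
      intro U hU
      refine Submodule.finrank_lt (s := U.restrictScalars ℂ) fun htop => hU ?_
      refine eq_top_iff.2 fun v _ => ?_
      have : v ∈ U.restrictScalars ℂ := htop ▸ Submodule.mem_top
      exact this
    by_cases hs : ∀ U : Submodule A V, U = ⊥ ∨ U = ⊤
    -- The kernel of an invariant form is a submodule, so for simple $V$ a nonzero form is
    -- injective. Otherwise the forms on two complementary submodules are added.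
    · obtain ⟨B, hB, hinv⟩ := h.exists_form hS (hχ V)
      let U : Submodule A V :=
        { carrier := {v | B v = 0}
          add_mem' := fun {v w} (hv : B v = 0) (hw : B w = 0) => show B (v + w) = 0 by
            rw [map_add, hv, hw, add_zero]
          zero_mem' := map_zero B
          smul_mem' := fun a v (hv : B v = 0) => show B (a • v) = 0 by
            ext w
            rw [hinv, hv]
            rfl }
      refine ⟨B, (injective_iff_map_eq_zero B).2 fun v hv => ?_, hinv⟩
      have hv' : v ∈ U := hv
      rcases hs U with hU | hU
      · rwa [hU, Submodule.mem_bot] at hv'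
      · refine absurd (LinearMap.ext fun w => ?_) hB
        have hw : w ∈ U := hU ▸ Submodule.mem_top
        exact hw
    · push Not at hs
      obtain ⟨U, hU0, hU1⟩ := hs
      have := h.isSemisimpleModule (V := V)
      obtain ⟨W, hUW⟩ := exists_isCompl U
      have hW1 : W ≠ ⊤ := by
        rintro rfl
        exact hU0 (by simpa using hUW.inf_eq_bot)
      have := hfin U
      have := hfin W
      obtain ⟨B, hB, hBinv⟩ := ih _ (hlt U hU1) U rfl
      obtain ⟨C, hC, hCinv⟩ := ih _ (hlt W hW1) W rfl
      let p : V →ₗ[A] U := U.projectionOnto W hUW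
      let q : V →ₗ[A] W := W.projectionOnto U hUW.symm
      have hpU : ∀ u : U, p u = u := Submodule.projectionOnto_apply_left hUW
      have hpW : ∀ w : W, p w = 0 := Submodule.projectionOnto_apply_right hUW
      have hqW : ∀ w : W, q w = w := Submodule.projectionOnto_apply_left hUW.symm
      have hqU : ∀ u : U, q u = 0 := Submodule.projectionOnto_apply_right hUW.symm
      refine ⟨LinearMap.compl₁₂ B (p.restrictScalars ℂ) (p.restrictScalars ℂ) +
        LinearMap.compl₁₂ C (q.restrictScalars ℂ) (q.restrictScalars ℂ),
        (injective_iff_map_eq_zero _).2 fun v hv => ?_, fun a v w => ?_⟩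
      · have hp : p v = 0 := hB (by
          ext u
          have := LinearMap.congr_fun hv (u : V)
          simpa [hpU, hqU] using this)
        have hq : q v = 0 := hC (by
          ext u
          have := LinearMap.congr_fun hv (u : V)
          simpa [hpW, hqW] using this)
        have h1 : v ∈ W := (Submodule.projectionOnto_apply_eq_zero_iff hUW).1 hp
        have h2 : v ∈ U := (Submodule.projectionOnto_apply_eq_zero_iff hUW.symm).1 hq
        exact Submodule.disjoint_def.1 hUW.disjoint v h2 h1
      · simp [hBinv, hCinv]

/-! ### Modules over the Drinfel'd double -/

namespace DrinfeldDouble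

variable {G : Type*} [Group G] [Fintype G] [DecidableEq G]

theorem sum_p_mul_tmul (b c : G) :
    ∑ z : G × G, ((p b c : DrinfeldDouble G) * p z.1 z.2) ⊗ₜ[ℂ]
        (p (z.2⁻¹ * z.1 * z.2) z.2⁻¹ : DrinfeldDouble G) =
      ∑ z : G × G, (p z.1 z.2 : DrinfeldDouble G) ⊗ₜ[ℂ]
        ((p (z.2⁻¹ * z.1 * z.2) z.2⁻¹ : DrinfeldDouble G) * p b c) := by
  simp only [Fintype.sum_prod_type_right, p_mul_p]
  refine Fintype.sum_equiv (Equiv.mulLeft c) _ _ fun h => ?_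
  rw [Finset.sum_eq_single (c⁻¹ * b * c), Finset.sum_eq_single b]
  · rw [if_pos (by group), Equiv.coe_mulLeft, if_pos (by group)]
    congr 2 <;> group
  · intro g _ hg
    rw [if_neg, TensorProduct.tmul_zero]
    intro h1
    apply hg
    simpa [mul_assoc] using h1
  · simp
  · intro g _ hg
    rw [if_neg, TensorProduct.zero_tmul]
    rintro rfl
    exact hg (by group)
  · simp

theorem sum_mul_p_tmul (b c : G) :
    ∑ z : G × G, ((p z.1 z.2 : DrinfeldDouble G) * p b c) ⊗ₜ[ℂ]
        (p (z.2⁻¹ * z.1 * z.2) z.2⁻¹ : DrinfeldDouble G) =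
      ∑ z : G × G, (p z.1 z.2 : DrinfeldDouble G) ⊗ₜ[ℂ]
        ((p b c : DrinfeldDouble G) * p (z.2⁻¹ * z.1 * z.2) z.2⁻¹) := by
  simp only [Fintype.sum_prod_type_right, p_mul_p]
  refine Fintype.sum_equiv (Equiv.mulRight c) _ _ fun h => ?_
  rw [Finset.sum_eq_single (h * b * h⁻¹), Finset.sum_eq_single (h * b * h⁻¹)]
  · rw [if_pos rfl, Equiv.coe_mulRight, if_pos (by group)]
    congr 2; group
  · intro g _ hg
    rw [if_neg, TensorProduct.tmul_zero]
    rintro rfl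
    apply hg
    rw [Equiv.coe_mulRight]
    group
  · simp
  · intro g _ hg
    rw [if_neg hg, TensorProduct.zero_tmul]
  · simp

/-- The symmetric separability element `|G|⁻¹ ∑ p_g h ⊗ h⁻¹ p_g` of the double. -/
theorem isSymmSeparability : IsSymmSeparability
    (fun z : G × G => (Fintype.card G : ℂ)⁻¹ • (p z.1 z.2 : DrinfeldDouble G))
    (fun z : G × G => p (z.2⁻¹ * z.1 * z.2) z.2⁻¹) where
  sum_mul := by
    have h1 : ∀ g h : G, (p g h * p (h⁻¹ * g * h) h⁻¹ : DrinfeldDouble G) = p g 1 := by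
      intro g h
      rw [p_mul_p, if_pos (by group), mul_inv_cancel]
    simp only [Fintype.sum_prod_type, smul_mul_assoc, h1, ← Finset.smul_sum, Finset.sum_const,
      Finset.card_univ]
    rw [← Nat.cast_smul_eq_nsmul ℂ, smul_smul, inv_mul_cancel₀ (by simp), one_smul, one_eq]
  outer a := by
    let L : DrinfeldDouble G →ₗ[ℂ] DrinfeldDouble G ⊗[ℂ] DrinfeldDouble G :=
      ∑ z : G × G, (TensorProduct.mk ℂ _ _).flip (p (z.2⁻¹ * z.1 * z.2) z.2⁻¹) ∘ₗ
        LinearMap.mulRight ℂ (p z.1 z.2)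
    let R : DrinfeldDouble G →ₗ[ℂ] DrinfeldDouble G ⊗[ℂ] DrinfeldDouble G :=
      ∑ z : G × G, TensorProduct.mk ℂ _ _ (p z.1 z.2) ∘ₗ
        LinearMap.mulLeft ℂ (p (z.2⁻¹ * z.1 * z.2) z.2⁻¹)
    have h : L = R := hom_ext fun b c => by
      simpa [L, R, LinearMap.sum_apply] using sum_p_mul_tmul b c
    simpa [L, R, LinearMap.sum_apply, ← TensorProduct.smul_tmul', ← Finset.smul_sum] using
      congrArg ((Fintype.card G : ℂ)⁻¹ • ·) (LinearMap.congr_fun h a)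
  inner a := by
    let L : DrinfeldDouble G →ₗ[ℂ] DrinfeldDouble G ⊗[ℂ] DrinfeldDouble G :=
      ∑ z : G × G, (TensorProduct.mk ℂ _ _).flip (p (z.2⁻¹ * z.1 * z.2) z.2⁻¹) ∘ₗ
        LinearMap.mulLeft ℂ (p z.1 z.2)
    let R : DrinfeldDouble G →ₗ[ℂ] DrinfeldDouble G ⊗[ℂ] DrinfeldDouble G :=
      ∑ z : G × G, TensorProduct.mk ℂ _ _ (p z.1 z.2) ∘ₗ
        LinearMap.mulRight ℂ (p (z.2⁻¹ * z.1 * z.2) z.2⁻¹)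
    have h : L = R := hom_ext fun b c => by
      simpa [L, R, LinearMap.sum_apply] using sum_mul_p_tmul b c
    simpa [L, R, LinearMap.sum_apply, ← TensorProduct.smul_tmul', ← Finset.smul_sum] using
      congrArg ((Fintype.card G : ℂ)⁻¹ • ·) (LinearMap.congr_fun h a)

/-- The group-like element of the double given by a group element. -/
def ofGroup (t : G) : DrinfeldDouble G := ∑ y, p y t

theorem ofGroup_mul_p (t g h : G) : ofGroup t * p g h = p (t * g * t⁻¹) (t * h) := by
  rw [ofGroup, Finset.sum_mul, Finset.sum_eq_single (t * g * t⁻¹)]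
  · rw [p_mul_p, if_pos rfl]
  · intro y _ hy
    rw [p_mul_p, if_neg hy]
  · simp

theorem p_mul_ofGroup (t g h : G) : p g h * ofGroup t = p g (h * t) := by
  rw [ofGroup, Finset.mul_sum, Finset.sum_eq_single (h⁻¹ * g * h)]
  · rw [p_mul_p, if_pos (by group)]
  · intro y _ hy
    rw [p_mul_p, if_neg]
    rintro rfl
    exact hy (by group)
  · simp

theorem ofGroup_mul_ofGroup (s t : G) :
    (ofGroup s * ofGroup t : DrinfeldDouble G) = ofGroup (s * t) := by
  rw [ofGroup, Finset.sum_mul]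
  simp only [p_mul_ofGroup]
  rfl

theorem ofGroup_one : (ofGroup 1 : DrinfeldDouble G) = 1 := one_eq.symm

variable {V : Type*} [AddCommGroup V] [Module ℂ V] [Module (DrinfeldDouble G) V]
  [IsScalarTower ℂ (DrinfeldDouble G) V]

theorem trace_actionHom_conj (t : G) (a : DrinfeldDouble G) :
    LinearMap.trace ℂ V (actionHom _ V (ofGroup t * a * ofGroup t⁻¹)) =
      LinearMap.trace ℂ V (actionHom _ V a) := by
  rw [map_mul, LinearMap.trace_mul_comm, ← map_mul, ← mul_assoc, ofGroup_mul_ofGroup,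
    inv_mul_cancel, ofGroup_one, one_mul]

/-- The element $p_g\bowtie h$ maps the component of degree $h^{-1}gh$ to that of degree $g$, so it
is traceless when these differ. -/
theorem trace_actionHom_p_eq_zero {g h : G} (hgh : ¬ Commute g h) :
    LinearMap.trace ℂ V (actionHom _ V (p g h : DrinfeldDouble G)) = 0 := by
  have h1 : (p g h : DrinfeldDouble G) = p g 1 * p g h := by
    rw [p_mul_p, if_pos (by group), one_mul]
  have h2 : (p g h * p g 1 : DrinfeldDouble G) = 0 := by
    rw [p_mul_p, if_neg]
    intro h3
    exact hgh (eq_mul_inv_iff_mul_eq.1 h3)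
  rw [h1, map_mul, LinearMap.trace_mul_comm, ← map_mul, h2, map_zero, map_zero]

/-- If all commuting pairs can be inverted simultaneously, then the antipode preserves
characters. -/
theorem trace_actionHom_antipode
    (hG : ∀ g h : G, Commute g h → ∃ t, g * t * g = t ∧ h * t * h = t) (a : DrinfeldDouble G) :
    LinearMap.trace ℂ V (actionHom _ V (HopfAlgebra.antipode ℂ a)) =
      LinearMap.trace ℂ V (actionHom _ V a) := by
  suffices (LinearMap.trace ℂ V ∘ₗ (actionHom (DrinfeldDouble G) V).toLinearMap) ∘ₗ
      HopfAlgebra.antipode ℂ =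
      LinearMap.trace ℂ V ∘ₗ (actionHom (DrinfeldDouble G) V).toLinearMap from
    LinearMap.congr_fun this a
  refine hom_ext fun g h => ?_
  simp only [LinearMap.comp_apply, antipode_p, AlgHom.toLinearMap_apply]
  by_cases hgh : Commute g h
  · obtain ⟨t, h1, h2⟩ := hG g h hgh
    -- For commuting $g,h$ the antipode of $p_g\bowtie h$ is $p_{g^{-1}}\bowtie h^{-1}$, its
    -- conjugate by $t$.
    have h3 : h⁻¹ * g⁻¹ * h = t * g * t⁻¹ := by
      rw [eq_mul_inv_iff_mul_eq, mul_assoc h⁻¹, hgh.inv_left.eq, inv_mul_cancel_left,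
        inv_mul_eq_iff_eq_mul, ← mul_assoc, h1]
    have h4 : h⁻¹ = t * h * t⁻¹ := by
      rw [eq_mul_inv_iff_mul_eq, inv_mul_eq_iff_eq_mul, ← mul_assoc, h2]
    rw [← trace_actionHom_conj t (p g h), ofGroup_mul_p, p_mul_ofGroup, ← h4, h3]
  · rw [trace_actionHom_p_eq_zero hgh, trace_actionHom_p_eq_zero]
    intro h1
    apply hgh
    have h3 : Commute g⁻¹ h⁻¹ := by
      have h4 := congrArg (fun z => h * z * h⁻¹) h1.eq
      simpa [mul_assoc, commute_iff_eq] using h4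
    exact Commute.inv_inv_iff.1 h3

end DrinfeldDouble

theorem isSelfDualModule_of_inverting {G : Type} [Group G] [Fintype G] [DecidableEq G]
    (hG : ∀ g h : G, Commute g h → ∃ t, g * t * g = t ∧ h * t * h = t)
    (V : Type) [AddCommGroup V] [Module ℂ V] [FiniteDimensional ℂ V]
    [Module (DrinfeldDouble G) V] [IsScalarTower ℂ (DrinfeldDouble G) V] :
    IsSelfDualModule (DrinfeldDouble G) V :=
  DrinfeldDouble.isSymmSeparability.exists_equiv_dual (S := HopfAlgebra.antipode ℂ)
    HopfAlgebra.antipode_mul_antidistrib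
    (fun _ _ _ _ _ _ a => DrinfeldDouble.trace_actionHom_antipode hG a) _ V rfl

/-! ### Left ideals generated by idempotents -/

/-- The left ideal generated by an idempotent `e` with `e A e = ℂ e` is simple if `A` is
semisimple. -/
theorem isSimpleModule_span_singleton {A : Type*} [Ring A] [Algebra ℂ A] [IsSemisimpleModule A A]
    {e : A} (he : e * e = e) (he0 : e ≠ 0) (hA : ∀ a, ∃ r : ℂ, e * a * e = r • e) :
    IsSimpleModule A (Submodule.span A {e}) := by
  have hmul : ∀ u ∈ Submodule.span A {e}, u * e = u := by
    intro u hu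
    obtain ⟨a, rfl⟩ := Submodule.mem_span_singleton.1 hu
    rw [smul_eq_mul, mul_assoc, he]
  -- Here $eu=eue$ is a nonzero multiple of $e$, so $e\in U$.
  have key : ∀ U : Submodule A A, U ≤ Submodule.span A {e} → ∀ u ∈ U, e * u ≠ 0 →
      U = Submodule.span A {e} := by
    intro U hU u hu hne
    refine le_antisymm hU (Submodule.span_le.2 (Set.singleton_subset_iff.2 ?_))
    obtain ⟨r, hr⟩ := hA u
    rw [mul_assoc, hmul u (hU hu)] at hr
    have hr0 : r ≠ 0 := by
      rintro rfl
      rw [zero_smul] at hr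
      exact hne hr
    have h1 : e = (r⁻¹ • e) * u := by
      rw [smul_mul_assoc, hr, smul_smul, inv_mul_cancel₀ hr0, one_smul]
    rw [SetLike.mem_coe, h1]
    exact U.smul_mem _ hu
  rw [isSimpleModule_iff_isAtom]
  refine ⟨fun h => he0 (Submodule.span_singleton_eq_bot.1 h), fun U hU => ?_⟩
  obtain ⟨W, hW⟩ := exists_isCompl U
  obtain ⟨u, hu, w, hw, huw⟩ := Submodule.mem_sup.1 (hW.sup_eq_top ▸ Submodule.mem_top : e ∈ U ⊔ W)
  by_contra hU0
  have heu : ∀ u ∈ U, e * u = 0 := fun u hu => by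
    by_contra hne
    exact hU.ne (key U hU.le u hu hne)
  have hwe : w ∈ W ⊓ Submodule.span A {e} := by
    refine ⟨hw, ?_⟩
    rw [← eq_sub_iff_add_eq'] at huw
    rw [huw]
    exact sub_mem (Submodule.mem_span_singleton_self e) (hU.le hu)
  have hew : e * w ≠ 0 := by
    intro h0
    apply he0
    have h1 : e * (u + w) = 0 := by rw [mul_add, heu u hu, h0, add_zero]
    rwa [huw, he] at h1
  have hW' := key _ inf_le_right w hwe hew
  exact hU0 (hW.disjoint.eq_bot_of_le (hU.le.trans (hW' ▸ inf_le_left)))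

/-- The character of the left ideal generated by an idempotent. -/
theorem trace_actionHom_span_singleton {A : Type*} [Ring A] [Algebra ℂ A] [FiniteDimensional ℂ A]
    {e : A} (he : e * e = e) (a : A) :
    LinearMap.trace ℂ _ (actionHom A (Submodule.span A {e}) a) =
      LinearMap.trace ℂ A (LinearMap.mulLeft ℂ a ∘ₗ LinearMap.mulRight ℂ e) := by
  have hmul : ∀ u ∈ Submodule.span A {e}, u * e = u := by
    intro u hu
    obtain ⟨b, rfl⟩ := Submodule.mem_span_singleton.1 hu
    rw [smul_eq_mul, mul_assoc, he]
  let ι : Submodule.span A {e} →ₗ[ℂ] A := (Submodule.span A {e}).subtype.restrictScalars ℂ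
  let π : A →ₗ[ℂ] Submodule.span A {e} :=
    { toFun := fun b => ⟨b * e, Submodule.mem_span_singleton.2 ⟨b, rfl⟩⟩
      map_add' := fun b c => Subtype.ext (add_mul b c e)
      map_smul' := fun r b => Subtype.ext (smul_mul_assoc r b e) }
  have : FiniteDimensional ℂ (Submodule.span A {e}) :=
    inferInstanceAs (FiniteDimensional ℂ ((Submodule.span A {e}).restrictScalars ℂ))
  have h1 : LinearMap.mulLeft ℂ a ∘ₗ LinearMap.mulRight ℂ e =
      (ι ∘ₗ actionHom A (Submodule.span A {e}) a) ∘ₗ π := rfl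
  have h2 : π ∘ₗ (ι ∘ₗ actionHom A (Submodule.span A {e}) a) =
      actionHom A (Submodule.span A {e}) a := by
    ext u
    exact hmul _ (Submodule.smul_mem _ a u.2)
  rw [h1, LinearMap.trace_comp_comm', h2]

/-! ### Modules of the double induced from linear characters of centralizers, and their second
indicators -/

namespace DrinfeldDouble

variable {G : Type*} [Group G] [Fintype G] [DecidableEq G]

omit [Group G] [Fintype G] [DecidableEq G] in
instance [Finite G] : FiniteDimensional ℂ (DrinfeldDouble G) :=
  inferInstanceAs (FiniteDimensional ℂ (G × G → ℂ))

theorem trace_eq_sum_coeff (f : DrinfeldDouble G →ₗ[ℂ] DrinfeldDouble G) :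
    LinearMap.trace ℂ _ f = ∑ x, ∑ y, coeff y x (f (p y x)) := by
  let b : Module.Basis (G × G) ℂ (DrinfeldDouble G) := Pi.basisFun ℂ (G × G)
  have hb : ∀ z, b z = p z.1 z.2 := fun z => Pi.basisFun_apply ℂ (G × G) z
  rw [LinearMap.trace_eq_matrix_trace ℂ b, Matrix.trace, Fintype.sum_prod_type_right]
  refine Finset.sum_congr rfl fun x _ => Finset.sum_congr rfl fun y _ => ?_
  rw [Matrix.diag_apply, LinearMap.toMatrix_apply, hb]
  rfl

theorem sweedlerPower_two_p (h : G) :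
    sweedlerPower (DrinfeldDouble G) 2 (p 1 h) =
      ∑ x, if x⁻¹ = h * x * h⁻¹ then p x⁻¹ (h * h) else 0 := by
  have h1 : ∀ a : DrinfeldDouble G, sweedlerPower (DrinfeldDouble G) 1 a = a := by
    intro a
    rw [sweedlerPower, pow_one]
    rfl
  rw [sweedlerPower_succ, comul_p, map_sum, map_sum]
  refine Finset.sum_congr rfl fun x _ => ?_
  rw [TensorProduct.map_tmul, h1, LinearMap.mul'_apply, LinearMap.id_apply, p_mul_p, mul_one]

theorem indicator_two_eq_sum (V : Type*) [AddCommGroup V] [Module ℂ V]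
    [Module (DrinfeldDouble G) V] [IsScalarTower ℂ (DrinfeldDouble G) V] :
    indicator (DrinfeldDouble G) V 2 = (Fintype.card G : ℂ)⁻¹ *
      ∑ h : G, ∑ x : G, if x⁻¹ = h * x * h⁻¹ then
        LinearMap.trace ℂ V (actionHom (DrinfeldDouble G) V (p x⁻¹ (h * h))) else 0 := by
  rw [indicator, isNormalizedIntegral.normalizedIntegral_eq, map_smul, map_smul, smul_eq_mul,
    map_sum, map_sum]
  congr 1
  refine Finset.sum_congr rfl fun h _ => ?_
  rw [sweedlerPower_two_p, map_sum]
  refine Finset.sum_congr rfl fun x _ => ?_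
  rw [apply_ite (moduleCharacter (DrinfeldDouble G) V), map_zero]
  rfl

section Induced

variable (g : G) (r : G → ℂ)

/-- The idempotent of the double given by an element `g` and a linear character `r` of its
centralizer, extended by zero. -/
def idem : DrinfeldDouble G :=
  (Nat.card (Subgroup.centralizer {g}) : ℂ)⁻¹ • ∑ c, r c⁻¹ • p g c

variable {g r} (hr0 : ∀ x, ¬ Commute g x → r x = 0)
  (hrmul : ∀ c x, Commute g c → r (c * x) = r c * r x) (hr1 : r 1 = 1)

include hr1 in
theorem idem_ne_zero : idem g r ≠ 0 := by
  intro h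
  have h1 := congrArg (coeff g 1) h
  have hK : (Nat.card (Subgroup.centralizer {g}) : ℂ) ≠ 0 := IsMonomialVector.natCard_ne_zero _
  rw [map_zero, idem, map_smul, map_sum, Finset.sum_eq_single 1] at h1
  · have h2 : (Nat.card (Subgroup.centralizer {g}) : ℂ)⁻¹ = 0 := by simpa [coeff_p, hr1] using h1
    exact inv_ne_zero hK h2
  · intro c _ hc
    simp [coeff_p, hc.symm]
  · simp

include hr0 hrmul hr1

theorem p_mul_idem (x : G) : (p g x * idem g r : DrinfeldDouble G) = r x • idem g r := by
  by_cases hx : Commute g x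
  · have hg : g = x * g * x⁻¹ := eq_mul_inv_iff_mul_eq.2 hx.eq
    simp only [idem, mul_smul_comm, Finset.mul_sum, p_mul_p]
    rw [smul_comm (r x), Finset.smul_sum (r := r x)]
    congr 1
    refine Fintype.sum_equiv (Equiv.mulLeft x) _ _ fun c => ?_
    rw [if_pos hg, smul_smul, Equiv.coe_mulLeft]
    congr 1
    by_cases hc : Commute g c
    · rw [mul_inv_rev, hrmul _ _ hc.inv_right, mul_left_comm, ← hrmul _ _ hx, mul_inv_cancel, hr1,
        mul_one]
    · have h0 : r (x * c)⁻¹ = 0 := by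
        refine hr0 _ fun h => hc ?_
        simpa using hx.inv_right.mul_right (Commute.inv_right_iff.1 h)
      rw [hr0 _ (mt Commute.inv_right_iff.1 hc)]
      exact (mul_eq_zero_of_right _ h0).symm
  · rw [hr0 x hx, zero_smul]
    simp only [idem, mul_smul_comm, Finset.mul_sum, p_mul_p]
    have hg : ¬ g = x * g * x⁻¹ := fun h => hx (eq_mul_inv_iff_mul_eq.1 h)
    simp [hg]

theorem sum_inv_mul (x : G) : ∑ c, r c⁻¹ * r (c * x) =
    Nat.card (Subgroup.centralizer {g}) * r x := by
  classical
  rw [← IsMonomialVector.sum_ite_mem, Finset.sum_mul]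
  refine Finset.sum_congr rfl fun c _ => ?_
  rw [Subgroup.mem_centralizer_singleton_iff]
  split_ifs with hc
  · have hc' : Commute g c := Eq.symm hc
    rw [hrmul _ _ hc', ← mul_assoc, ← hrmul _ _ hc'.inv_right, inv_mul_cancel, hr1]
  · rw [hr0 c⁻¹, zero_mul, zero_mul]
    rw [Commute.inv_right_iff]
    exact fun h => hc (Eq.symm h)

/-- This supplies the criterion $eD(G)e=\mathbb{C}e$ for simplicity of the left ideal generated by
$e$. -/
theorem idem_mul_p_mul_idem (y x : G) :
    idem g r * p y x * idem g r = (if y = g then r x else 0) • idem g r := by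
  have hK : (Nat.card (Subgroup.centralizer {g}) : ℂ) ≠ 0 := IsMonomialVector.natCard_ne_zero _
  have h1 : idem g r * p y x = if y = g then
      (Nat.card (Subgroup.centralizer {g}) : ℂ)⁻¹ • ∑ c, r c⁻¹ • p g (c * x) else 0 := by
    simp only [idem, smul_mul_assoc, Finset.sum_mul, p_mul_p]
    split_ifs with hy
    · congr 1
      refine Finset.sum_congr rfl fun c _ => ?_
      by_cases hc : Commute g c
      · rw [if_pos]
        rw [hy]
        exact eq_mul_inv_iff_mul_eq.2 hc.eq
      · rw [hr0 _ (mt Commute.inv_right_iff.1 hc), zero_smul, zero_smul]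
    · rw [Finset.sum_eq_zero, smul_zero]
      intro c _
      by_cases hc : Commute g c
      · rw [if_neg, smul_zero]
        intro h
        apply hy
        rw [eq_mul_inv_iff_mul_eq, hc.eq] at h
        exact (mul_left_cancel h).symm
      · rw [hr0 _ (mt Commute.inv_right_iff.1 hc), zero_smul]
  rw [h1]
  split_ifs with hy
  · rw [smul_mul_assoc, Finset.sum_mul]
    simp only [smul_mul_assoc, p_mul_idem hr0 hrmul hr1, smul_smul]
    rw [← Finset.sum_smul, sum_inv_mul hr0 hrmul hr1, smul_smul, inv_mul_cancel_left₀ hK]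
  · rw [zero_mul, zero_smul]

theorem idem_mul_idem : idem g r * idem g r = idem g r := by
  have hK : (Nat.card (Subgroup.centralizer {g}) : ℂ) ≠ 0 := IsMonomialVector.natCard_ne_zero _
  have h1 := sum_inv_mul hr0 hrmul hr1 1
  simp only [mul_one, hr1] at h1
  have h2 : idem g r * idem g r = (Nat.card (Subgroup.centralizer {g}) : ℂ)⁻¹ •
      ∑ c, r c⁻¹ • (p g c * idem g r) := by
    conv_lhs => rw [idem, smul_mul_assoc, Finset.sum_mul]
    simp only [smul_mul_assoc]
    rfl
  rw [h2]
  simp only [p_mul_idem hr0 hrmul hr1, smul_smul]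
  rw [← Finset.sum_smul, h1, smul_smul, inv_mul_cancel₀ hK, one_smul]

theorem isSimpleModule_idem :
    IsSimpleModule (DrinfeldDouble G) (Submodule.span (DrinfeldDouble G) {idem g r}) := by
  have := isSymmSeparability.isSemisimpleModule (A := DrinfeldDouble G) (V := DrinfeldDouble G)
  refine isSimpleModule_span_singleton (idem_mul_idem hr0 hrmul hr1) (idem_ne_zero hr1)
    fun a => ?_
  refine ⟨∑ y, ∑ x, coeff y x a * (if y = g then r x else 0), ?_⟩
  conv_lhs => rw [eq_sum a]
  simp only [Finset.mul_sum, Finset.sum_mul, mul_smul_comm, smul_mul_assoc,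
    idem_mul_p_mul_idem hr0 hrmul hr1, Finset.sum_smul, smul_smul]

end Induced

theorem trace_idem {g : G} {r : G → ℂ} (y k : G) :
    LinearMap.trace ℂ (DrinfeldDouble G)
        (LinearMap.mulLeft ℂ (p y k) ∘ₗ LinearMap.mulRight ℂ (idem g r)) =
      (Nat.card (Subgroup.centralizer {g}) : ℂ)⁻¹ * ∑ x, if y = k * y * k⁻¹ then
        if y = (k * x) * g * (k * x)⁻¹ then r (x⁻¹ * k * x) else 0 else 0 := by
  rw [trace_eq_sum_coeff, Finset.mul_sum]
  refine Finset.sum_congr rfl fun x _ => ?_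
  have h1 : ∀ X, p y X * idem g r = if y = X * g * X⁻¹ then
      (Nat.card (Subgroup.centralizer {g}) : ℂ)⁻¹ • ∑ c, r c⁻¹ • p y (X * c) else 0 := by
    intro X
    simp only [idem, mul_smul_comm, Finset.mul_sum, p_mul_p]
    split_ifs <;> simp
  simp only [LinearMap.comp_apply, LinearMap.mulLeft_apply, LinearMap.mulRight_apply,
    ← mul_assoc (p y k), p_mul_p]
  rw [Finset.sum_eq_single (k⁻¹ * y * k)]
  · rw [if_pos (by group), h1]
    by_cases hy : y = k * x * g * (k * x)⁻¹
    · rw [if_pos hy, if_pos hy, map_smul, map_sum, smul_eq_mul]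
      congr 1
      rw [Finset.sum_eq_single (x⁻¹ * k⁻¹ * x)]
      · rw [map_smul, coeff_p, smul_eq_mul]
        have h2 : (k⁻¹ * y * k = y ∧ x = k * x * (x⁻¹ * k⁻¹ * x)) ↔ y = k * y * k⁻¹ := by
          rw [and_iff_left (by group), mul_assoc, inv_mul_eq_iff_eq_mul, eq_mul_inv_iff_mul_eq]
        simp only [h2]
        simp only [mul_ite, mul_one, mul_zero, mul_inv_rev, inv_inv, ← mul_assoc]
      · intro c _ hc
        rw [map_smul, coeff_p, if_neg, smul_zero]
        rintro ⟨-, h2⟩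
        apply hc
        rw [mul_assoc, eq_inv_mul_iff_mul_eq, eq_inv_mul_iff_mul_eq, ← mul_assoc]
        exact h2.symm
      · simp
    · rw [if_neg hy, if_neg hy, map_zero, ite_self, mul_zero]
  · intro z _ hz
    rw [if_neg]
    · simp
    · rintro rfl
      exact hz (by group)
  · simp

/-- A term with $x=wg^{-1}w^{-1}$ is transported by conjugation with $w$ to $g$ itself. The
contribution is then independent of $w$, and the $|G|$ copies cancel the normalization of the
integral. -/
theorem indicator_two_idem {g : G} {r : G → ℂ} (hr0 : ∀ x, ¬ Commute g x → r x = 0)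
    (hrmul : ∀ c x, Commute g c → r (c * x) = r c * r x) (hr1 : r 1 = 1) :
    indicator (DrinfeldDouble G) (Submodule.span (DrinfeldDouble G) {idem g r}) 2 =
      (Nat.card (Subgroup.centralizer {g}) : ℂ)⁻¹ *
        ∑ h, if g * h * g = h then r (h * h) else 0 := by
  have hG : (Fintype.card G : ℂ) ≠ 0 := by simp
  have h1 : ∀ h x : G, (if x⁻¹ = h * x * h⁻¹ then
      LinearMap.trace ℂ _ (actionHom (DrinfeldDouble G)
        (Submodule.span (DrinfeldDouble G) {idem g r}) (p x⁻¹ (h * h))) else 0) =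
      (Nat.card (Subgroup.centralizer {g}) : ℂ)⁻¹ * ∑ w, if x = w * g⁻¹ * w⁻¹ then
        if g * (w⁻¹ * h * w) * g = w⁻¹ * h * w then
          r ((w⁻¹ * h * w) * (w⁻¹ * h * w)) else 0 else 0 := by
    intro h x
    rw [trace_actionHom_span_singleton (idem_mul_idem hr0 hrmul hr1), trace_idem, ← mul_ite_zero]
    congr 1
    have hiff : ∀ w, x = w * g⁻¹ * w⁻¹ →
        (g * (w⁻¹ * h * w) * g = w⁻¹ * h * w ↔ x⁻¹ = h * x * h⁻¹) := by
      rintro w rfl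
      obtain ⟨y, rfl⟩ : ∃ y, h = w * y * w⁻¹ := ⟨w⁻¹ * h * w, by group⟩
      have e1 : w⁻¹ * (w * y * w⁻¹) * w = y := by group
      have e2 : w * y * w⁻¹ * (w * g⁻¹ * w⁻¹) * (w * y * w⁻¹)⁻¹ = w * (y * g⁻¹ * y⁻¹) * w⁻¹ := by
        group
      have e3 : (w * g⁻¹ * w⁻¹)⁻¹ = w * g * w⁻¹ := by group
      rw [e1, e2, e3, mul_left_inj, mul_right_inj, eq_mul_inv_iff_mul_eq, eq_mul_inv_iff_mul_eq]
    by_cases hA : x⁻¹ = h * x * h⁻¹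
    · have hx : h * h * x⁻¹ * (h * h)⁻¹ = x⁻¹ := by
        have h2 : h * x⁻¹ * h⁻¹ = x := by simpa [mul_assoc] using (congrArg (·⁻¹) hA).symm
        calc h * h * x⁻¹ * (h * h)⁻¹ = h * (h * x⁻¹ * h⁻¹) * h⁻¹ := by group
          _ = x⁻¹ := by rw [h2, ← hA]
      rw [if_pos hA]
      refine Finset.sum_congr rfl fun w _ => ?_
      rw [if_pos hx.symm]
      have h2 : x⁻¹ = h * h * w * g * (h * h * w)⁻¹ ↔ x = w * g⁻¹ * w⁻¹ := by
        have e1 : h * h * w * g * (h * h * w)⁻¹ = h * h * (w * g⁻¹ * w⁻¹)⁻¹ * (h * h)⁻¹ := by group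
        rw [e1, ← hx]
        simp only [mul_left_inj, mul_right_inj, inv_inj]
      simp only [h2]
      split_ifs with hw hw2
      · congr 1
        group
      · exact absurd ((hiff w hw).2 hA) hw2
      · rfl
    · rw [if_neg hA]
      refine (Finset.sum_eq_zero fun w _ => ?_).symm
      split_ifs with hw hw2
      · exact absurd ((hiff w hw).1 hw2) hA
      · rfl
      · rfl
  rw [indicator_two_eq_sum]
  simp only [h1, ← Finset.mul_sum]
  rw [mul_left_comm]
  congr 1
  rw [inv_mul_eq_iff_eq_mul₀ hG]
  have h2 : ∀ h : G, (∑ x : G, ∑ w : G, if x = w * g⁻¹ * w⁻¹ then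
        if g * (w⁻¹ * h * w) * g = w⁻¹ * h * w then
          r ((w⁻¹ * h * w) * (w⁻¹ * h * w)) else 0 else 0) =
      ∑ w : G, if g * (w⁻¹ * h * w) * g = w⁻¹ * h * w then
          r ((w⁻¹ * h * w) * (w⁻¹ * h * w)) else 0 := by
    intro h
    rw [Finset.sum_comm]
    simp
  simp only [h2]
  rw [Finset.sum_comm]
  have h3 : ∀ w : G, (∑ h : G, if g * (w⁻¹ * h * w) * g = w⁻¹ * h * w then
          r ((w⁻¹ * h * w) * (w⁻¹ * h * w)) else 0) =
      ∑ h, if g * h * g = h then r (h * h) else 0 := fun w =>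
    Fintype.sum_equiv ((Equiv.mulLeft w⁻¹).trans (Equiv.mulRight w)) _ _ fun h => rfl
  simp only [h3, Finset.sum_const, Finset.card_univ, nsmul_eq_mul]

/-- An element `g` with commutative centralizer that is inverted by some `t`, and all of whose
inverting elements have the same square `z ≠ 1`, gives an irreducible module over the double with
second indicator `-1`. -/
theorem exists_indicator_two_eq_neg_one {G : Type} [Group G] [Fintype G] [DecidableEq G] {g z : G}
    (hz : z ≠ 1) (hzz : z * z = 1) (hgz : Commute g z)
    (hsq : ∀ x, g * x * g = x → x * x = z)
    (hcomm : ∀ x y, Commute g x → Commute g y → Commute x y) (ht : ∃ t, g * t * g = t) :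
    ∃ (W : Type) (_ : AddCommGroup W) (_ : Module ℂ W) (_ : FiniteDimensional ℂ W)
      (_ : Module (DrinfeldDouble G) W) (_ : IsScalarTower ℂ (DrinfeldDouble G) W),
      IsSimpleModule (DrinfeldDouble G) W ∧ indicator (DrinfeldDouble G) W 2 = -1 := by
  classical
  have hmem : ∀ {x}, x ∈ Subgroup.centralizer {g} ↔ Commute g x := fun {x} => by
    rw [Subgroup.mem_centralizer_singleton_iff]
    exact eq_comm
  let _ : CommGroup (Subgroup.centralizer {g}) :=
    { (inferInstance : Group (Subgroup.centralizer {g})) with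
      mul_comm := fun x y => Subtype.ext (hcomm x y (hmem.1 x.2) (hmem.1 y.2)) }
  -- Linear characters of the finite abelian group $C_G(g)$ separate $z$ from 1; since $z^2=1$, the
  -- value at $z$ must be $-1$.
  obtain ⟨ρ, hρ⟩ := CommGroup.exists_apply_ne_one_of_hasEnoughRootsOfUnity
    (Subgroup.centralizer {g}) ℂ (a := ⟨z, hmem.2 hgz⟩) (by simpa [Subtype.ext_iff] using hz)
  let r : G → ℂ := fun x => if hx : x ∈ Subgroup.centralizer {g} then (ρ ⟨x, hx⟩ : ℂˣ) else 0
  have hr : ∀ x (hx : Commute g x), r x = (ρ ⟨x, hmem.2 hx⟩ : ℂˣ) := fun x hx =>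
    dif_pos (hmem.2 hx)
  have hr0 : ∀ x, ¬ Commute g x → r x = 0 := fun x hx => dif_neg (mt hmem.1 hx)
  have hrmul : ∀ c x, Commute g c → r (c * x) = r c * r x := by
    intro c x hc
    by_cases hx : Commute g x
    · rw [hr _ (hc.mul_right hx), hr _ hc, hr _ hx, ← Units.val_mul, ← map_mul]
      rfl
    · rw [hr0 x hx, hr0, mul_zero]
      intro h
      apply hx
      simpa using hc.inv_right.mul_right h
  have hr1 : r 1 = 1 := by
    rw [hr 1 (Commute.one_right g)]
    exact congrArg Units.val (map_one ρ)
  have hrz : r z = -1 := by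
    have h1 : r z * r z = 1 := by rw [← hrmul z z hgz, hzz, hr1]
    refine (mul_self_eq_one_iff.1 h1).resolve_left fun h2 => hρ ?_
    rw [hr z hgz] at h2
    exact Units.ext h2
  refine ⟨Submodule.span (DrinfeldDouble G) {idem g r}, inferInstance, inferInstance,
    inferInstanceAs (FiniteDimensional ℂ
      ((Submodule.span (DrinfeldDouble G) {idem g r}).restrictScalars ℂ)),
    inferInstance, inferInstance, isSimpleModule_idem hr0 hrmul hr1, ?_⟩
  rw [indicator_two_idem hr0 hrmul hr1, inv_mul_eq_iff_eq_mul₀ (IsMonomialVector.natCard_ne_zero _),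
    ← IsMonomialVector.sum_ite_mem, Finset.sum_mul]
  obtain ⟨t, ht⟩ := ht
  symm
  -- The elements inverting $g$ form the coset $C_G(g)t$, and each contributes $r(z)=-1$.
  refine Fintype.sum_equiv (Equiv.mulRight t) _ _ fun c => ?_
  have h1 : g * (c * t) * g = c * t ↔ c ∈ Subgroup.centralizer {g} := by
    rw [hmem, Commute, SemiconjBy, ← mul_left_inj (a := t) (b := g * c)]
    have e1 : g * c * t = g * (c * t) * g * g⁻¹ := by group
    have e2 : c * g * t = c * t * g⁻¹ := by rw [eq_mul_inv_iff_mul_eq, mul_assoc, mul_assoc,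
      ← mul_assoc g, ht]
    rw [e1, e2, mul_left_inj]
  rw [Equiv.coe_mulRight]
  simp only [h1]
  split_ifs with hc
  · rw [hsq _ (h1.2 hc), hrz, one_mul]
  · rw [zero_mul]

end DrinfeldDouble

/-! ### Transport to the presented groups -/

namespace DihedralExt

variable {l k : ℕ} [Fact (3 ≤ l)] [Fact (4 ∣ k)] [NeZero k]

local notation "ψ" => DihedralModel.presentedEquiv (l := l) (k := k)

instance : Finite (DihedralExt l k) := Finite.of_equiv _ (ψ).symm.toEquiv

theorem natCard_eq : Nat.card (DihedralExt l k) = 2 ^ l * (2 * k) := by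
  rw [Nat.card_congr (ψ).toEquiv, DihedralModel.card_eq]

theorem exists_inverting {g h : DihedralExt l k} (hgh : Commute g h) :
    ∃ t, g * t * g = t ∧ h * t * h = t := by
  obtain ⟨t, h1, h2⟩ := DihedralModel.exists_inverting (hgh.map ψ)
  refine ⟨(ψ).symm t, (ψ).injective ?_, (ψ).injective ?_⟩ <;> simpa

theorem isCompletelyReal : IsCompletelyReal (DihedralExt l k) := fun g => by
  obtain ⟨t, ht, -⟩ := exists_inverting (Commute.refl g)
  rw [isConj_iff]
  refine ⟨t, ?_⟩
  rw [mul_inv_eq_iff_eq_mul, eq_inv_mul_iff_mul_eq, ← mul_assoc, ht]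

theorem isGeneratedByInvolutions : IsGeneratedByInvolutions (DihedralExt l k) := by
  have h := congrArg (Subgroup.map ((ψ).symm : DihedralModel l k →* DihedralExt l k))
    (DihedralModel.closure_orderOf_eq_two (l := l) (k := k))
  rw [MonoidHom.map_closure, Subgroup.map_top_of_surjective _ (ψ).symm.surjective] at h
  rw [IsGeneratedByInvolutions, eq_top_iff, ← h]
  refine Subgroup.closure_mono ?_
  rintro _ ⟨g, hg, rfl⟩
  exact (MulEquiv.orderOf_eq (ψ).symm g).trans hg

variable (l k) in
/-- An abelian normal subgroup with abelian quotient. -/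
def base : Subgroup (DihedralExt l k) :=
  (DihedralModel.base l k).comap ((ψ : DihedralExt l k ≃* DihedralModel l k) :
    DihedralExt l k →* DihedralModel l k)

theorem commute_of_mem_base : ∀ x ∈ base l k, ∀ y ∈ base l k, x * y = y * x := fun x hx y hy =>
  (ψ).injective (by simpa using DihedralModel.commute_of_mem_base hx hy)

theorem commutator_mem_base (x y : DihedralExt l k) : x * y * x⁻¹ * y⁻¹ ∈ base l k := by
  rw [base, Subgroup.mem_comap]
  simpa using DihedralModel.commutator_mem_base ((ψ) x) ((ψ) y)

theorem exists_inverting_mod_commutator (K : Subgroup (DihedralExt l k)) (hK : base l k ≤ K) :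
    ∃ t : DihedralExt l k, t * t = 1 ∧ ∀ x ∈ K, t * x * t⁻¹ * x ∈ ⁅K, K⁆ := by
  let f : DihedralExt l k →* DihedralModel l k := (ψ)
  have hK' : DihedralModel.base l k ≤ K.map f := by
    intro x hx
    refine ⟨(ψ).symm x, hK ?_, (ψ).apply_symm_apply x⟩
    rw [base, Subgroup.mem_comap]
    simpa using hx
  obtain ⟨t, ht, h⟩ := DihedralModel.exists_inverting_mod_commutator hK'
  refine ⟨(ψ).symm t, by rw [← map_mul, ht, map_one], fun x hx => ?_⟩
  obtain ⟨y, hy, hxy⟩ := Subgroup.map_commutator K K f ▸ h (f x) ⟨x, hx, rfl⟩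
  have h1 : (ψ).symm t * x * ((ψ).symm t)⁻¹ * x = y := by
    apply (ψ).injective
    refine Eq.trans ?_ hxy.symm
    simp [f]
  exact h1 ▸ hy

theorem indicator_nonneg (V : Type*) [AddCommGroup V] [Module ℂ V] [FiniteDimensional ℂ V]
    [Module (MonoidAlgebra ℂ (DihedralExt l k)) V]
    [IsScalarTower ℂ (MonoidAlgebra ℂ (DihedralExt l k)) V] (m : ℕ) :
    0 ≤ (indicator (MonoidAlgebra ℂ (DihedralExt l k)) V m).re ∧
      (indicator (MonoidAlgebra ℂ (DihedralExt l k)) V m).im = 0 := by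
  open scoped ComplexOrder in
  classical
  have := Fintype.ofFinite (DihedralExt l k)
  have := Fintype.ofFinite (DihedralModel l k)
  let ρ : DihedralModel l k →* Module.End ℂ V :=
    (moduleRep (DihedralExt l k) V).comp
      ((ψ).symm : DihedralModel l k →* DihedralExt l k)
  have h1 : ∑ g, LinearMap.trace ℂ V (moduleRep (DihedralExt l k) V (g ^ m)) =
      ∑ x, LinearMap.trace ℂ V (ρ (x ^ m)) :=
    Fintype.sum_equiv (ψ).toEquiv _ _ fun g => by simp [ρ]
  have h2 : 0 ≤ indicator (MonoidAlgebra ℂ (DihedralExt l k)) V m := by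
    rw [indicator_eq_sum, h1]
    refine mul_nonneg (inv_nonneg.2 (Nat.cast_nonneg _)) ?_
    rcases m.even_or_odd with hm | hm
    · exact DihedralModel.sum_trace_pow_nonneg_of_even ρ hm
    · exact DihedralModel.sum_trace_pow_nonneg_of_odd ρ hm
  rw [Complex.nonneg_iff] at h2
  exact ⟨h2.1, h2.2.symm⟩

theorem exists_indicator_two_eq_neg_one [Fintype (DihedralExt l k)]
    [DecidableEq (DihedralExt l k)] :
    ∃ (W : Type) (_ : AddCommGroup W) (_ : Module ℂ W) (_ : FiniteDimensional ℂ W)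
      (_ : Module (DrinfeldDouble (DihedralExt l k)) W)
      (_ : IsScalarTower ℂ (DrinfeldDouble (DihedralExt l k)) W),
      IsSimpleModule (DrinfeldDouble (DihedralExt l k)) W ∧
        indicator (DrinfeldDouble (DihedralExt l k)) W 2 = -1 := by
  have hcomm {x y : DihedralExt l k} : Commute ((ψ) x) ((ψ) y) ↔ Commute x y := by
    rw [commute_iff_eq, commute_iff_eq, ← map_mul, ← map_mul, (ψ).injective.eq_iff]
  obtain ⟨g, hg⟩ := (ψ).surjective (DihedralModel.S 1 0)
  have hgg := DihedralModel.S_one_zero_mul_self (l := l) (k := k)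
  rw [← hg, ← map_mul] at hgg
  refine DrinfeldDouble.exists_indicator_two_eq_neg_one (g := g) (z := g * g) ?_ ?_ ?_ ?_ ?_ ?_
  · intro h
    rw [h, map_one] at hgg
    exact DihedralModel.R_half_ne_one hgg.symm
  · apply (ψ).injective
    rw [map_mul, hgg, map_one, DihedralModel.R_mul_R, DihedralModel.R_eq_one, map_zero]
    exact ⟨by linear_combination DihedralModel.two_mul_half (l := l), add_zero 0⟩
  · exact (Commute.refl g).mul_right (Commute.refl g)
  · intro x hx
    apply (ψ).injective
    rw [hgg, map_mul, DihedralModel.mul_self_of_inverts]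
    rw [← hg, ← map_mul, ← map_mul, hx]
  · intro x y hx hy
    rw [← hcomm, hg] at hx hy
    exact hcomm.1 (DihedralModel.commute_of_commute_S hx hy)
  · obtain ⟨t, ht, -⟩ := exists_inverting (Commute.refl g)
    exact ⟨t, ht⟩

theorem exists_semidirectProduct :
    ∃ φ : DihedralGroup k →* MulAut (Multiplicative (ZMod (2 ^ l))),
      (∀ x, φ (DihedralGroup.r 1) x = x ^ (2 ^ (l - 1) + 1)) ∧
      (∀ x, φ (DihedralGroup.sr 0) x = x ^ (2 ^ (l - 1) - 1)) ∧
      Nonempty (DihedralExt l k ≃* Multiplicative (ZMod (2 ^ l)) ⋊[φ] DihedralGroup k) := by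
  refine ⟨DihedralModel.action l k, fun x => ?_, fun x => ?_, ⟨ψ⟩⟩
  · apply Multiplicative.toAdd.injective
    rw [toAdd_pow, nsmul_eq_mul, DihedralModel.natCast_half_add_one, DihedralModel.action_apply]
    show (1 + DihedralModel.twist 1) * x.toAdd = _
    rw [DihedralModel.twist_one, add_comm]
  · apply Multiplicative.toAdd.injective
    rw [toAdd_pow, nsmul_eq_mul, DihedralModel.natCast_half_sub_one, DihedralModel.action_apply]
    show (DihedralModel.half l - 1 + DihedralModel.twist 0) * x.toAdd = _
    rw [map_zero, add_zero]

end DihedralExt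

end

theorem mainTheorem1 :
    (∀ l k : ℕ, 3 ≤ l → 0 < k → 4 ∣ k →
      -- the presented group is the finite semidirect product `ℤ_(2^l) ⋊ D_k`
      (∃ φ : DihedralGroup k →* MulAut (Multiplicative (ZMod (2 ^ l))),
        (∀ x, φ (DihedralGroup.r 1) x = x ^ (2 ^ (l - 1) + 1)) ∧
        (∀ x, φ (DihedralGroup.sr 0) x = x ^ (2 ^ (l - 1) - 1)) ∧
        Nonempty (DihedralExt l k ≃* Multiplicative (ZMod (2 ^ l)) ⋊[φ] DihedralGroup k)) ∧
      Finite (DihedralExt l k) ∧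
      IsCompletelyReal (DihedralExt l k) ∧
      IsGeneratedByInvolutions (DihedralExt l k) ∧
      (∀ g : DihedralExt l k, IsMGroup (Subgroup.centralizer {g})) ∧
      IsMGroup (DihedralExt l k) ∧
      IsTotallyOrthogonal (DihedralExt l k) ∧
      -- all irreducible `G`-modules have second indicator `1`
      (∀ (V : Type) [AddCommGroup V] [Module ℂ V] [FiniteDimensional ℂ V]
        [Module (MonoidAlgebra ℂ (DihedralExt l k)) V]
        [IsScalarTower ℂ (MonoidAlgebra ℂ (DihedralExt l k)) V],
        IsSimpleModule (MonoidAlgebra ℂ (DihedralExt l k)) V →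
          indicator (MonoidAlgebra ℂ (DihedralExt l k)) V 2 = 1) ∧
      -- all higher indicators of all `G`-modules are nonnegative reals
      (∀ (V : Type) [AddCommGroup V] [Module ℂ V] [FiniteDimensional ℂ V]
        [Module (MonoidAlgebra ℂ (DihedralExt l k)) V]
        [IsScalarTower ℂ (MonoidAlgebra ℂ (DihedralExt l k)) V] (m : ℕ), 1 ≤ m →
          0 ≤ (indicator (MonoidAlgebra ℂ (DihedralExt l k)) V m).re ∧
          (indicator (MonoidAlgebra ℂ (DihedralExt l k)) V m).im = 0) ∧
      ∀ [Fintype (DihedralExt l k)] [DecidableEq (DihedralExt l k)],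
        -- all `D(G)`-modules are self-dual
        (∀ (V : Type) [AddCommGroup V] [Module ℂ V] [FiniteDimensional ℂ V]
          [Module (DrinfeldDouble (DihedralExt l k)) V]
          [IsScalarTower ℂ (DrinfeldDouble (DihedralExt l k)) V],
          IsSelfDualModule (DrinfeldDouble (DihedralExt l k)) V) ∧
        -- some irreducible `D(G)`-module has second indicator `-1`
        (∃ (W : Type) (_ : AddCommGroup W) (_ : Module ℂ W) (_ : FiniteDimensional ℂ W)
          (_ : Module (DrinfeldDouble (DihedralExt l k)) W)
          (_ : IsScalarTower ℂ (DrinfeldDouble (DihedralExt l k)) W),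
          IsSimpleModule (DrinfeldDouble (DihedralExt l k)) W ∧
          indicator (DrinfeldDouble (DihedralExt l k)) W 2 = -1)) ∧
    -- infinitely many of these groups are pairwise non-isomorphic
    (∃ F : ℕ → ℕ × ℕ, (∀ n, 3 ≤ (F n).1 ∧ 0 < (F n).2 ∧ 4 ∣ (F n).2) ∧
      Pairwise fun i j =>
        IsEmpty (DihedralExt (F i).1 (F i).2 ≃* DihedralExt (F j).1 (F j).2)) := by
  -- With $k=4$ fixed, the orders $2^{n+3}\cdot8$ distinguish the groups.
  refine ⟨fun l k hl hk hkd => ?_, fun n => (n + 3, 4), fun n => by simp, fun i j hij => ⟨fun f => ?_⟩⟩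
  · have : Fact (3 ≤ l) := ⟨hl⟩
    have : Fact (4 ∣ k) := ⟨hkd⟩
    have : NeZero k := ⟨hk.ne'⟩
    have hN := DihedralExt.commute_of_mem_base (l := l) (k := k)
    have hcomm := DihedralExt.commutator_mem_base (l := l) (k := k)
    have hinv := DihedralExt.exists_inverting_mod_commutator (l := l) (k := k)
    exact ⟨DihedralExt.exists_semidirectProduct, inferInstance, DihedralExt.isCompletelyReal,
      DihedralExt.isGeneratedByInvolutions,
      fun g => isMGroup_subgroup_of_commutator_mem hN hcomm _,
      isMGroup_of_commutator_mem hN hcomm, isTotallyOrthogonal_of_inverting hN hcomm hinv,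
      fun V _ _ _ _ _ _ => indicator_two_eq_one_of_inverting hN hcomm hinv,
      fun V _ _ _ _ _ m _ => DihedralExt.indicator_nonneg V m,
      fun {_ _} => ⟨fun V _ _ _ _ _ =>
        isSelfDualModule_of_inverting (fun _ _ => DihedralExt.exists_inverting) V,
        DihedralExt.exists_indicator_two_eq_neg_one⟩⟩
  · have : Fact (3 ≤ i + 3) := ⟨by omega⟩
    have : Fact (3 ≤ j + 3) := ⟨by omega⟩
    have : Fact (4 ∣ 4) := ⟨dvd_rfl⟩
    have h := Nat.card_congr f.toEquiv
    rw [DihedralExt.natCard_eq, DihedralExt.natCard_eq, Nat.mul_left_inj (by norm_num)] at h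
    exact hij (Nat.add_right_cancel (Nat.pow_right_injective le_rfl h))
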